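/- Let $\mathrm k$ be a field of characteristic zero. Let $\Delta$ be an irreducible reduced crystallographic root system with Weyl group $W$, simple roots $\{\alpha_i\}_{i\in I}$, root lattice $Y$, weight lattice $X$, coweight lattice $X^\vee$; put $X_{\mathrm k}=\mathrm k\otimes X$, $X^\vee_{\mathrm k}=\mathrm k\otimes X^\vee$, with the natural pairing $(\,:\,)$. Let $\theta$ be the root whose coroot $\theta^\vee$ is the maximal coroot (so $\theta$ is the maximal root if $\Delta$ is simply laced, and the maximal short root otherwise). Let $\hat W=Y\rtimes W$ be the affine Weyl group, with elements $x_y w$ ($y\in Y$, $w\in W$), and put $\hat I=I\cup\{\heartsuit\}$, $s_i=s_{\alpha_i}$ for $i\in I$, $s_\heartsuit=x_\theta s_\theta$. Let $\mathbf S'$ be the symmetric algebra of $X^\vee_{\mathrm k}$, write $\xi_\nu\in\mathbf S'$ for the element given by $\nu\in X^\vee_{\mathrm k}$, and put $\xi_{\alpha_\heartsuit^\vee}=1-\xi_{\theta^\vee}$. The group $\hat W$ acts on $X_{\mathrm k}$ by $x_yw(\mu)=y+w\mu$ and on $\mathbf S'$ by algebra automorphisms with ${}^{x_yw}\xi_\nu=\xi_{w\nu}-(y:w\nu)$.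 Let $(h_\beta)_{\beta\in\Delta}$ be a $W$-invariant family of elements of $\mathrm k$; put $h_i=h_{\alpha_i}$ for $i\in I$ and $h_\heartsuit=h_\theta$. The degenerate double affine Hecke algebra $\mathbf H'$ is the $\mathrm k$-algebra generated by the group algebra $\mathrm k\hat W$ and $\mathbf S'$ with the relations $$s_i\,p-{}^{s_i}p\,s_i=h_i\,\frac{p-{}^{s_i}p}{\xi_{\alpha_i^\vee}}\qquad(i\in\hat I,\ p\in\mathbf S').$$ For $\mu\in X_{\mathrm k}$ let $\langle\mu\rangle\subset\mathbf S'$ be the ideal of the $p$ with $p(\mu)=0$, and let $[\mu]\subset\mathbf S'$ be the ideal generated by the elements of $\langle\mu\rangle$ invariant under the stabilizer of $\mu$ in $\hat W$. For a finite set $E\subset X_{\mathrm k}$ put $\langle E\rangle=\bigcap_{\mu\in E}\langle\mu\rangle$ and $[E]=\bigcap_{\mu\in E}[\mu]$. Let $\mathcal O'$ be the category of finitely generated left $\mathbf H'$-modules $M$ that are locally finite over $\mathbf S'$ (that is, $\mathbf S'm$ is finite-dimensional over $\mathrm k$ for every $m\in M$). Fix $\lambda\in X_{\mathrm k}$. Let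 ${}^{\{\lambda\}}\mathcal O\subset\mathcal O'$ be the full subcategory of the modules $M$ such that for every $m\in M$ there are a finite set $E\subset\hat W\lambda$ and an integer $n>0$ with $\langle E\rangle^n m=0$, and let ${}^\lambda\mathcal O\subset{}^{\{\lambda\}}\mathcal O$ be the full subcategory of the modules $M$ such that for every $m\in M$ there is a finite set $E\subset\hat W\lambda$ with $[E]m=0$. For $\mu\in\hat W\lambda$ put $P(\mu)=\mathbf H'/\mathbf H'[\mu]$. **Proposition 2.2.** (i) For each $\mu\in\hat W\lambda$, the module $P(\mu)$ belongs to ${}^\lambda\mathcal O$ and is a projective object of ${}^\lambda\mathcal O$. (ii) The category ${}^\lambda\mathcal O$ is generated by the modules $P(\mu)$, $\mu\in\hat W\lambda$: every object of ${}^\lambda\mathcal O$ is a quotient of a finite direct sum of such modules. (iii) The category $\mathcal O'$ is Artinian, i.e. it is an abelian category in which every object has finite length; and ${}^\lambda\mathcal O$ has only finitely many simple objects up to isomorphism. -/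

import Mathlib

open CategoryTheory
open scoped ModuleCat DirectSum

universe u

noncomputable section

namespace DDAHA

/-! Throughout, `k` is a field of characteristic zero and `P` is an irreducible reduced
crystallographic root system over `k`.  The space `V` spanned by the roots is `X_k = k ⊗ X`, the
space `V'` spanned by the coroots is `X_k^∨ = k ⊗ X^∨`, and `P.toLinearMap` is the pairing `( : )`.
-/

variable {k ι V V' : Type u} [Field k] [AddCommGroup V] [Module k V] [AddCommGroup V'] [Module k V']
variable (P : RootPairing ι k V V')

/-! ### The affine Weyl group -/

/-- The root lattice `Y`, as a subgroup of `X_k`. -/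
abbrev RootLattice : AddSubgroup V := AddSubgroup.closure (Set.range P.root)

lemma smul_mem_rootLattice (w : P.weylGroup) {y : V} (hy : y ∈ RootLattice P) :
    w • y ∈ RootLattice P := by
  induction hy using AddSubgroup.closure_induction with
  | mem x hx =>
    obtain ⟨i, rfl⟩ := hx
    rw [RootPairing.weylGroup_apply_root]
    exact AddSubgroup.subset_closure ⟨_, rfl⟩
  | zero => rw [smul_zero]; exact zero_mem _
  | add x y _ _ hx hy => rw [smul_add]; exact add_mem hx hy
  | neg x _ hx => rw [smul_neg]; exact neg_mem hx

/-- The Weyl group acts on the root lattice. -/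
instance : DistribMulAction P.weylGroup (RootLattice P) where
  smul w y := ⟨w • (y : V), smul_mem_rootLattice P w y.2⟩
  one_smul y := Subtype.ext (one_smul _ (y : V))
  mul_smul v w y := Subtype.ext (mul_smul v w (y : V))
  smul_zero w := Subtype.ext (smul_zero w)
  smul_add w x y := Subtype.ext (smul_add w (x : V) (y : V))

/-- The action of the Weyl group on the root lattice, written multiplicatively. -/
def weylHom : P.weylGroup →* MulAut (Multiplicative (RootLattice P)) where
  toFun w := AddEquiv.toMultiplicative (DistribMulAction.toAddEquiv (RootLattice P) w)
  map_one' := by ext y; exact one_smul P.weylGroup (y.toAdd : V)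
  map_mul' v w := by ext y; exact mul_smul v w (y.toAdd : V)

/-- The affine Weyl group `Ŵ = Y ⋊ W`. -/
abbrev AffineWeyl : Type u :=
  SemidirectProduct (Multiplicative (RootLattice P)) P.weylGroup (weylHom P)

/-- The component `y ∈ Y ⊆ X_k` of `x_y w ∈ Ŵ`. -/
def AffineWeyl.transl (g : AffineWeyl P) : V := (g.left.toAdd : RootLattice P)

/-- The action of `Ŵ` on `X_k`: `x_y w` sends `μ` to `y + w μ`. -/
instance : MulAction (AffineWeyl P) V where
  smul g μ := g.transl P + g.right • μ
  one_smul μ := by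
    change (0 : V) + (1 : P.weylGroup) • μ = μ
    rw [one_smul, zero_add]
  mul_smul g g' μ := by
    change (g.transl P + g.right • g'.transl P) + (g.right * g'.right) • μ =
      g.transl P + g.right • (g'.transl P + g'.right • μ)
    rw [smul_add, mul_smul, add_assoc]

/-- The linear action of `W` on `X_k^∨`; it satisfies `(w μ : w ν) = (μ : ν)`. -/
def coweightAct (w : P.weylGroup) : V' →ₗ[k] V' :=
  RootPairing.Hom.coweightMap (RootPairing.Equiv.toHom ((w⁻¹ : P.weylGroup) : P.Aut))

/-! ### The symmetric algebra of `X_k^∨` and the action of `Ŵ` on it -/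

/-- `S'`, the symmetric algebra of `X_k^∨` over `k`. -/
abbrev SPrime (_P : RootPairing ι k V V') : Type u := SymmetricAlgebra k V'

/-- The element `ξ_ν` of `S'`. -/
abbrev xi (ν : V') : SPrime P := SymmetricAlgebra.ι k V' ν

/-- The evaluation `p ↦ p(μ)` at a point `μ` of `X_k`. -/
def evalAt (μ : V) : SPrime P →ₐ[k] k := SymmetricAlgebra.lift (P.toLinearMap μ)

/-- The action of `g = x_y w ∈ Ŵ` on `S'`: `ᵍξ_ν = ξ_{wν} - (y : wν)`. -/
def act (g : AffineWeyl P) : SPrime P →ₐ[k] SPrime P :=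
  SymmetricAlgebra.lift
    ((SymmetricAlgebra.ι k V' - (Algebra.linearMap k (SPrime P)).comp
      (P.toLinearMap (g.transl P))).comp (coweightAct P g.right))

variable {P}
variable (b : P.Base) (θ : ι)

/-- `θ` is the root whose coroot is the maximal coroot relative to the base `b`. -/
def IsMaxCoroot : Prop :=
  ∀ j : ι, P.coroot θ - P.coroot j ∈ AddSubmonoid.closure (P.coroot '' b.support)

/-- The affine simple reflections, indexed by `Î = I ∪ {♥}`: `s_i` for `i ∈ I`, and
`s_♥ = x_θ s_θ`. -/
def simpleRefl : Option b.support → AffineWeyl P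
  | some i => SemidirectProduct.inr (RootPairing.weylGroup.ofIdx P i)
  | none => ⟨Multiplicative.ofAdd ⟨P.root θ, AddSubgroup.subset_closure ⟨θ, rfl⟩⟩,
      RootPairing.weylGroup.ofIdx P θ⟩

/-- The affine functions `ξ_{α_i^∨}` for `i ∈ Î`; here `ξ_{α_♥^∨} = 1 - ξ_{θ^∨}`. -/
def simpleXi : Option b.support → SPrime P
  | some i => xi P (P.coroot i)
  | none => 1 - xi P (P.coroot θ)

/-- The parameters `h_i` for `i ∈ Î`; here `h_♥ = h_θ`. -/
def simpleParam (h : ι → k) : Option b.support → k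
  | some i => h i
  | none => h θ

lemma coweightAct_ofIdx (i : ι) (ν : V') :
    coweightAct P (RootPairing.weylGroup.ofIdx P i) ν
      = ν - P.toLinearMap (P.root i) ν • P.coroot i := by
  have h : (((RootPairing.weylGroup.ofIdx P i)⁻¹ : P.weylGroup) : P.Aut)
      = RootPairing.Equiv.reflection P i := by
    rw [Subgroup.coe_inv]
    exact RootPairing.Equiv.reflection_inv P i
  rw [coweightAct, h]
  exact P.coreflection_apply i ν

lemma simpleXi_dvd (i : Option b.support) (p : SPrime P) :
    simpleXi b θ i ∣ p - act P (simpleRefl b θ i) p := by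
  induction p using SymmetricAlgebra.induction with
  | algebraMap r => simp
  | ι ν =>
    cases i with
    | some i =>
      have ht : (simpleRefl b θ (some i)).transl P = 0 := rfl
      have hr : (simpleRefl b θ (some i)).right = RootPairing.weylGroup.ofIdx P i := rfl
      refine ⟨algebraMap k _ (P.toLinearMap (P.root i) ν), ?_⟩
      rw [act, SymmetricAlgebra.lift_ι_apply, ht, hr]
      simp only [LinearMap.comp_apply, coweightAct_ofIdx, map_zero, LinearMap.comp_zero, sub_zero,
        map_sub, map_smul, simpleXi, Algebra.smul_def]
      ring
    | none =>
      have ht : (simpleRefl b θ none).transl P = P.root θ := rfl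
      have hr : (simpleRefl b θ none).right = RootPairing.weylGroup.ofIdx P θ := rfl
      refine ⟨- algebraMap k _ (P.toLinearMap (P.root θ) ν), ?_⟩
      rw [act, SymmetricAlgebra.lift_ι_apply, ht, hr]
      simp only [LinearMap.comp_apply, LinearMap.sub_apply, coweightAct_ofIdx,
        map_sub, map_smul, simpleXi, Algebra.smul_def, Algebra.linearMap_apply, P.root_coroot_two θ, map_ofNat]
      ring
  | mul p q hp hq =>
    have : p * q - act P (simpleRefl b θ i) (p * q)
        = (p - act P (simpleRefl b θ i) p) * q
          + act P (simpleRefl b θ i) p * (q - act P (simpleRefl b θ i) q) := by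
      rw [map_mul]; ring
    rw [this]
    exact dvd_add (hp.mul_right _) (hq.mul_left _)
  | add p q hp hq =>
    have : p + q - act P (simpleRefl b θ i) (p + q)
        = (p - act P (simpleRefl b θ i) p) + (q - act P (simpleRefl b θ i) q) := by
      rw [map_add]; ring
    rw [this]
    exact dvd_add hp hq

/-- The divided difference `ϑ_{α_i^∨}(p) = (p - ^{s_i}p) / ξ_{α_i^∨}` for `i ∈ Î`
(the quotient exists by `simpleXi_dvd`, and is unique as `S'` is a domain and `ξ_{α_i^∨} ≠ 0`). -/
def divDiff (i : Option b.support) (p : SPrime P) : SPrime P :=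
  Classical.choose (simpleXi_dvd b θ i p)

lemma simpleXi_mul_divDiff (i : Option b.support) (p : SPrime P) :
    simpleXi b θ i * divDiff b θ i p = p - act P (simpleRefl b θ i) p :=
  (Classical.choose_spec (simpleXi_dvd b θ i p)).symm

/-! ### The degenerate double affine Hecke algebra -/

variable (h : ι → k)

/-- The defining relations of `H'` on the free algebra on the set `Ŵ ⊔ S'`: those of the group
algebra `kŴ`, those of the algebra `S'`, and the cross relations
`s_i p - ^{s_i}p s_i = h_i ϑ_{α_i^∨}(p)` for `i ∈ Î` and `p ∈ S'`. -/
inductive Rel : FreeAlgebra k (AffineWeyl P ⊕ SPrime P) →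
    FreeAlgebra k (AffineWeyl P ⊕ SPrime P) → Prop
  | group_one : Rel (FreeAlgebra.ι k (Sum.inl 1)) 1
  | group_mul (g g' : AffineWeyl P) : Rel (FreeAlgebra.ι k (Sum.inl (g * g')))
      (FreeAlgebra.ι k (Sum.inl g) * FreeAlgebra.ι k (Sum.inl g'))
  | sym_algebraMap (c : k) : Rel (FreeAlgebra.ι k (Sum.inr (algebraMap k (SPrime P) c)))
      (algebraMap k _ c)
  | sym_add (p q : SPrime P) : Rel (FreeAlgebra.ι k (Sum.inr (p + q)))
      (FreeAlgebra.ι k (Sum.inr p) + FreeAlgebra.ι k (Sum.inr q))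
  | sym_mul (p q : SPrime P) : Rel (FreeAlgebra.ι k (Sum.inr (p * q)))
      (FreeAlgebra.ι k (Sum.inr p) * FreeAlgebra.ι k (Sum.inr q))
  | cross (i : Option b.support) (p : SPrime P) :
      Rel (FreeAlgebra.ι k (Sum.inl (simpleRefl b θ i)) * FreeAlgebra.ι k (Sum.inr p)
          - FreeAlgebra.ι k (Sum.inr (act P (simpleRefl b θ i) p)) *
            FreeAlgebra.ι k (Sum.inl (simpleRefl b θ i)))
        (simpleParam b θ h i • FreeAlgebra.ι k (Sum.inr (divDiff b θ i p)))

/-- The degenerate double affine Hecke algebra `H'`. -/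
def HPrime : Type u := RingQuot (Rel b θ h)

instance : Ring (HPrime b θ h) := inferInstanceAs (Ring (RingQuot (Rel b θ h)))
instance : Algebra k (HPrime b θ h) := inferInstanceAs (Algebra k (RingQuot (Rel b θ h)))

/-- The quotient map onto `H'`. -/
def mkH : FreeAlgebra k (AffineWeyl P ⊕ SPrime P) →ₐ[k] HPrime b θ h :=
  RingQuot.mkAlgHom k (Rel b θ h)

lemma mkH_rel {x y : FreeAlgebra k (AffineWeyl P ⊕ SPrime P)} (hxy : Rel b θ h x y) :
    mkH b θ h x = mkH b θ h y :=
  RingQuot.mkAlgHom_rel k hxy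

/-- The canonical map `S' → H'`. -/
def ofS : SPrime P →ₐ[k] HPrime b θ h where
  toFun p := mkH b θ h (FreeAlgebra.ι k (Sum.inr p))
  map_one' := by
    have := mkH_rel b θ h (Rel.sym_algebraMap 1)
    simpa using this
  map_mul' p q := by rw [mkH_rel b θ h (Rel.sym_mul p q), map_mul]
  map_zero' := by
    have := mkH_rel b θ h (Rel.sym_algebraMap 0)
    simpa using this
  map_add' p q := by rw [mkH_rel b θ h (Rel.sym_add p q), map_add]
  commutes' c := by rw [mkH_rel b θ h (Rel.sym_algebraMap c), AlgHom.commutes]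

/-! ### The categories of modules -/

variable (P) in
/-- The maximal ideal `⟨μ⟩ = {p - p(μ)}` of `S'`. -/
def maxIdeal (μ : V) : Ideal (SPrime P) := RingHom.ker (evalAt P μ)

variable (P) in
/-- `[μ]`: the ideal of `S'` generated by the elements of `⟨μ⟩` which are invariant under the
stabilizer of `μ` in `Ŵ`. -/
def invIdeal (μ : V) : Ideal (SPrime P) :=
  Ideal.span {p | p ∈ maxIdeal P μ ∧ ∀ g ∈ MulAction.stabilizer (AffineWeyl P) μ, act P g p = p}

/-- The action map `S' → M`, `p ↦ p m`. -/
def actOn (M : ModuleCat.{u} (HPrime b θ h)) (m : M) : SPrime P →ₗ[k] M :=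
  ((LinearMap.toSpanSingleton (HPrime b θ h) M m).restrictScalars k).comp
    (ofS b θ h).toLinearMap

/-- `O'`: the finitely generated left `H'`-modules `M` that are locally finite over `S'`, i.e.
`S' m` is finite-dimensional over `k` for all `m ∈ M`. -/
def catO : ObjectProperty (ModuleCat.{u} (HPrime b θ h)) := fun M =>
  Module.Finite (HPrime b θ h) M ∧ ∀ m : M, (LinearMap.range (actOn b θ h M m)).FG

/-- `^{λ}O` (with braces): the modules `M` in `O'` such that every `m ∈ M` is killed by `⟨E⟩^n` for
some finite subset `E` of the orbit `Ŵ λ` and some `n > 0`. -/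
def catOGen (lam : V) : ObjectProperty (ModuleCat.{u} (HPrime b θ h)) := fun M =>
  catO b θ h M ∧ ∀ m : M, ∃ E : Finset V, (E : Set V) ⊆ MulAction.orbit (AffineWeyl P) lam ∧
    ∃ n : ℕ, 0 < n ∧ ∀ p ∈ (⨅ μ ∈ E, maxIdeal P μ) ^ n, ofS b θ h p • m = 0

/-- `^λO` (without braces): the modules `M` in `^{λ}O` such that every `m ∈ M` is killed by
`[E] = ⋂_{μ ∈ E} [μ]` for some finite subset `E` of the orbit `Ŵ λ`. -/
def catOLam (lam : V) : ObjectProperty (ModuleCat.{u} (HPrime b θ h)) := fun M =>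
  catOGen b θ h lam M ∧ ∀ m : M, ∃ E : Finset V,
    (E : Set V) ⊆ MulAction.orbit (AffineWeyl P) lam ∧
    ∀ p ∈ (⨅ μ ∈ E, invIdeal P μ), ofS b θ h p • m = 0

/-- `P(μ) = H' / H'[μ]`. -/
def PMod (μ : V) : ModuleCat.{u} (HPrime b θ h) :=
  ModuleCat.of (HPrime b θ h)
    (HPrime b θ h ⧸ Submodule.span (HPrime b θ h) (ofS b θ h '' (invIdeal P μ : Set (SPrime P))))

/-- An Artinian category: an abelian category in which every object has finite length, i.e.
satisfies the descending and the ascending chain conditions on subobjects. -/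
def IsArtinianCategory (C : Type*) [Category C] : Prop :=
  Nonempty (Abelian C) ∧ ∀ X : C, IsArtinianObject X ∧ IsNoetherianObject X

end DDAHA

end

/-!
Three facts about the ideals `[μ]` carry the proof.

* `[μ]` has radical `⟨μ⟩` and finite codimension, so `[μ]` and `[μ']` are comaximal for `μ ≠ μ'`
  (`radical_invIdeal`, `finite_quotient_invIdeal`, `isCoprime_invIdeal`).
* The divided difference of `p ∈ [μ] ∩ [s_i μ]` belongs to `[μ]` (`divDiff_mem_invIdeal`). Hence in
  any `H'`-module, if `m` is killed by `[E]`, then `s_i m` is killed by `[E ∪ s_i E]`. As `H'` is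
  generated by `S'` and the `s_i`, the vectors killed by some `[E]` form a submodule, and `P(μ)`
  belongs to `^λO`.
* `Hom(P(μ), M)` is the set of vectors of `M` killed by `[μ]`, and for `M` in `^λO` a vector killed
  by `[E]` is, by comaximality, the sum of its components killed by the `[μ]`, `μ ∈ E`. The
  components are obtained by acting with elements of `S'`, so they commute with morphisms; this gives
  the projectivity of `P(μ)` (`projective_PMod`) and the generation of `^λO` by the `P(μ)`
  (`exists_surjective_directSum`).

Finite length. Let `M` be finitely generated and locally finite over `S'`, with generators killed by
an ideal `J` of finite codimension. Filter `M` by the length of words in the simple reflections. On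
the graded pieces `S'` acts through the quotients by the translates `ᵍJ`, `g ∈ Ŵ`, so every nonzero
submodule of a quotient of `M` contains a nonzero vector killed by some `ᵍJ`
(`exists_twist_le_torsionOf`). The intertwiners `φ_i = s_i ξ_{α_i^∨} - h_i` satisfy
`φ_i p = ^{s_i}p φ_i` and `φ_i² = h_i² - ξ_{α_i^∨}²`, so `φ_i` carries such a vector to one killed by
`^{s_i g}J`, which is nonzero except when `ξ_{α_i^∨}² - h_i²` and `ᵍJ` are not comaximal. Let `x₀` be
a point of the open fundamental alcove. If `g x₀` is separated from `x₀` by the wall of `s_i`, then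
`s_i g x₀` is closer to `x₀` (`alcoveDist_simpleRefl_mul_lt`); so one can descend until, for every
`i ∈ Î`, the value of `ξ_{α_i^∨}` at `g x₀` is bounded below by a constant which depends only on `J`
and `h`. There are finitely many such `g` (`exists_finite_twist`). Let `I` be the product of the
corresponding `ᵍJ`. Thus every nonzero subquotient of `M` contains a nonzero vector killed by `I`,
and `N ↦ {x ∈ N | Iⁿ x = 0 for some n}` is strictly monotone in the submodule `N` of `M`. Its values
are contained in a step of the word filtration, because only finitely many translates `ᵍJ` are not
comaximal to `I`, and this step has finite length over `S'`
(`isArtinian_isNoetherian_of_locallyFinite`).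

The same descent, for `J = [λ]`, shows that each simple object of `^λO` is a quotient of one of
finitely many modules `P(gλ)`. These have finite length, hence finitely many simple quotients.

The descent uses that `Ŵ` is generated by the `s_i`, `i ∈ Î` (`closure_simpleRefl`), which rests on
the maximality of `θ^∨`.
-/

noncomputable section

namespace DDAHA

variable {k ι V V' : Type u} [Field k] [AddCommGroup V] [Module k V] [AddCommGroup V'] [Module k V']
variable {P : RootPairing ι k V V'}

/-! ### The affine Weyl group and its action on polynomial functions -/

lemma toLinearMap_coweightAct (w : P.weylGroup) (μ : V) (ν : V') :
    P.toLinearMap μ (coweightAct P w ν) = P.toLinearMap (w⁻¹ • μ) ν := by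
  have h := RootPairing.Hom.weight_coweight_transpose_apply P P ν
    (RootPairing.Equiv.toHom ((w⁻¹ : P.weylGroup) : P.Aut))
  exact (LinearMap.congr_fun h μ).symm

lemma coweight_ext {ν ν' : V'} (h : ∀ μ : V, P.toLinearMap μ ν = P.toLinearMap μ ν') : ν = ν' :=
  P.flip.toPerfPair.injective (LinearMap.ext h)

lemma coweightAct_coroot (w : P.weylGroup) (j : ι) :
    ∃ j', coweightAct P w (P.coroot j) = P.coroot j' :=
  ⟨_, RootPairing.Hom.coroot_coweightMap_apply P P j _⟩

lemma smul_def (g : AffineWeyl P) (μ : V) : g • μ = g.transl P + g.right • μ := rfl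

lemma transl_one : (1 : AffineWeyl P).transl P = 0 := rfl

lemma transl_mul (g g' : AffineWeyl P) :
    (g * g').transl P = g.transl P + g.right • g'.transl P := rfl

lemma affineWeyl_ext {g g' : AffineWeyl P} (h₁ : g.transl P = g'.transl P)
    (h₂ : g.right = g'.right) : g = g' :=
  SemidirectProduct.ext (Subtype.ext h₁) h₂

lemma act_xi (g : AffineWeyl P) (ν : V') :
    act P g (xi P ν) = xi P (coweightAct P g.right ν)
      - algebraMap k _ (P.toLinearMap (g.transl P) (coweightAct P g.right ν)) := by
  rw [act, xi, SymmetricAlgebra.lift_ι_apply]; rfl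

lemma xi_neg (ν : V') : xi P (-ν) = -xi P ν := map_neg _ ν

lemma evalAt_xi (μ : V) (ν : V') : evalAt P μ (xi P ν) = P.toLinearMap μ ν := by
  rw [evalAt, xi, SymmetricAlgebra.lift_ι_apply]

lemma act_one : act P (1 : AffineWeyl P) = AlgHom.id k _ := by
  refine SymmetricAlgebra.algHom_ext (LinearMap.ext fun ν => ?_)
  have h : coweightAct P (1 : AffineWeyl P).right ν = ν := coweight_ext (P := P) fun μ => by
    rw [toLinearMap_coweightAct]; simp
  change act P 1 (xi P ν) = xi P ν
  rw [act_xi, h, transl_one]; simp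

lemma act_mul (g g' : AffineWeyl P) : act P (g * g') = (act P g).comp (act P g') := by
  refine SymmetricAlgebra.algHom_ext (LinearMap.ext fun ν => ?_)
  change act P (g * g') (xi P ν) = act P g (act P g' (xi P ν))
  have h : coweightAct P (g * g').right ν
      = coweightAct P g.right (coweightAct P g'.right ν) := coweight_ext (P := P) fun μ => by
    simp only [toLinearMap_coweightAct, SemidirectProduct.mul_right, mul_inv_rev, mul_smul]
  rw [act_xi, act_xi, map_sub, act_xi, h, AlgHom.commutes, transl_mul, map_add,
    LinearMap.add_apply, toLinearMap_coweightAct g.right (g.right • _), inv_smul_smul, map_add]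
  abel

lemma act_mul_apply (g g' : AffineWeyl P) (p : SPrime P) :
    act P (g * g') p = act P g (act P g' p) := by rw [act_mul]; rfl

lemma act_one_apply (p : SPrime P) : act P (1 : AffineWeyl P) p = p := by rw [act_one]; rfl

lemma act_inv_act (g : AffineWeyl P) (p : SPrime P) : act P g⁻¹ (act P g p) = p := by
  rw [← act_mul_apply, inv_mul_cancel, act_one_apply]

lemma act_act_inv (g : AffineWeyl P) (p : SPrime P) : act P g (act P g⁻¹ p) = p := by
  rw [← act_mul_apply, mul_inv_cancel, act_one_apply]

/-- The action on functions is contragredient to the action on points. -/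
lemma evalAt_smul_act (g : AffineWeyl P) (μ : V) (p : SPrime P) :
    evalAt P (g • μ) (act P g p) = evalAt P μ p := by
  suffices (evalAt P (g • μ)).comp (act P g) = evalAt P μ from AlgHom.congr_fun this p
  refine SymmetricAlgebra.algHom_ext (LinearMap.ext fun ν => ?_)
  change evalAt P (g • μ) (act P g (xi P ν)) = evalAt P μ (xi P ν)
  rw [act_xi, map_sub, evalAt_xi, evalAt_xi, AlgHom.commutes, smul_def, map_add,
    LinearMap.add_apply, toLinearMap_coweightAct g.right (g.right • _), inv_smul_smul]
  simp

lemma evalAt_act (g : AffineWeyl P) (μ : V) (p : SPrime P) :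
    evalAt P μ (act P g p) = evalAt P (g⁻¹ • μ) p := by
  rw [← evalAt_smul_act g (g⁻¹ • μ), smul_inv_smul]

lemma weight_ext [P.IsRootSystem] {μ μ' : V}
    (h : ∀ j, P.toLinearMap μ (P.coroot j) = P.toLinearMap μ' (P.coroot j)) : μ = μ' := by
  refine P.toPerfPair.injective ?_
  exact LinearMap.ext_on_range (v := P.coroot) RootPairing.IsRootSystem.span_coroot_eq_top h

section Finiteness

variable [Finite ι] [P.IsRootSystem]

instance finite_weylGroup : Finite P.weylGroup := by
  refine Finite.of_injective (fun w : P.weylGroup => RootPairing.Equiv.indexHom P (w : P.Aut)) ?_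
  intro w w' h
  refine Subtype.ext (RootPairing.Equiv.weightHom_injective P (LinearEquiv.toLinearMap_injective ?_))
  refine LinearMap.ext_on_range (v := P.root) RootPairing.IsRootSystem.span_root_eq_top fun j => ?_
  change (w : P.Aut) • P.root j = (w' : P.Aut) • P.root j
  rw [← RootPairing.Equiv.root_indexEquiv_eq_smul, ← RootPairing.Equiv.root_indexEquiv_eq_smul]
  exact congrArg P.root (Equiv.congr_fun h j)

lemma finite_setOf_smul_mem (μ : V) {A : Set V} (hA : A.Finite) :
    {g : AffineWeyl P | g • μ ∈ A}.Finite := by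
  refine Set.Finite.of_finite_image (f := fun g : AffineWeyl P => (g • μ, g.right))
    ((hA.prod Set.finite_univ).subset ?_) ?_
  · rintro _ ⟨g, hg, rfl⟩
    exact ⟨hg, Set.mem_univ _⟩
  · intro g _ g' _ h
    obtain ⟨h₁, h₂⟩ := Prod.mk.inj h
    refine affineWeyl_ext ?_ h₂
    rw [smul_def, smul_def, h₂] at h₁
    exact add_right_cancel h₁

instance finite_stabilizer (μ : V) : Finite (MulAction.stabilizer (AffineWeyl P) μ) :=
  (finite_setOf_smul_mem μ (Set.finite_singleton μ)).to_subtype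

lemma finite_setOf_pairing_mem {A : Set k} (hA : A.Finite) :
    {μ : V | ∀ j, P.toLinearMap μ (P.coroot j) ∈ A}.Finite := by
  refine Set.Finite.of_finite_image (f := fun μ j => P.toLinearMap μ (P.coroot j))
    ((Set.Finite.pi' fun _ : ι => hA).subset ?_) ?_
  · rintro _ ⟨μ, hμ, rfl⟩ j
    exact hμ j
  · intro μ _ μ' _ h
    exact weight_ext fun j => congrFun h j

lemma finite_setOf_simple_pairing_mem (b : P.Base) {A : b.support → Set k}
    (hA : ∀ i, (A i).Finite) :
    {μ : V | ∀ i : b.support, P.toLinearMap μ (P.coroot i) ∈ A i}.Finite := by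
  refine Set.Finite.of_finite_image (f := fun μ (i : b.support) => P.toLinearMap μ (P.coroot i))
    ((Set.Finite.pi' hA).subset ?_) ?_
  · rintro _ ⟨μ, hμ, rfl⟩ i
    exact hμ i
  · intro μ _ μ' _ h
    refine P.toPerfPair.injective (b.toCoweightBasis.ext fun i => ?_)
    rw [b.toCoweightBasis_apply]
    exact congrFun h i

lemma finite_setOf_transl_mem {A : Set k} (hA : A.Finite) :
    {g : AffineWeyl P | ∀ j, P.toLinearMap (g.transl P) (P.coroot j) ∈ A}.Finite := by
  refine (finite_setOf_smul_mem (0 : V) (finite_setOf_pairing_mem (P := P) hA)).subset fun g hg => ?_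
  simpa [smul_def] using hg

end Finiteness

section Simple

variable (b : P.Base) (θ : ι)

lemma ofIdx_mul_self (i : ι) :
    RootPairing.weylGroup.ofIdx P i * RootPairing.weylGroup.ofIdx P i = 1 := by
  refine Subtype.ext ?_
  change RootPairing.Equiv.reflection P i * RootPairing.Equiv.reflection P i = 1
  rw [mul_eq_one_iff_eq_inv, RootPairing.Equiv.reflection_inv]

lemma ofIdx_smul_eq (i : ι) (μ : V) :
    RootPairing.weylGroup.ofIdx P i • μ = μ - P.toLinearMap μ (P.coroot i) • P.root i :=
  P.reflection_apply i μ

/-- The root in whose direction `s_i` reflects: `α_i` for `i ∈ I` and `-θ` for `i = ♥`. -/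
def simpleRoot : Option b.support → V
  | some i => P.root i
  | none => -P.root θ

lemma simpleRefl_smul (i : Option b.support) (μ : V) :
    simpleRefl b θ i • μ = μ - evalAt P μ (simpleXi b θ i) • simpleRoot b θ i := by
  cases i with
  | some i =>
    change (0 : V) + RootPairing.weylGroup.ofIdx P i • μ = _
    rw [ofIdx_smul_eq, simpleXi, evalAt_xi, zero_add]; rfl
  | none =>
    change P.root θ + RootPairing.weylGroup.ofIdx P θ • μ = _
    rw [ofIdx_smul_eq, simpleXi, map_sub, evalAt_xi, map_one, simpleRoot, smul_neg, sub_smul,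
      one_smul]
    abel

lemma simpleRefl_mul_self (i : Option b.support) : simpleRefl b θ i * simpleRefl b θ i = 1 := by
  cases i with
  | some i =>
    change SemidirectProduct.inr _ * SemidirectProduct.inr _ = _
    rw [← map_mul, ofIdx_mul_self, map_one]
  | none =>
    refine affineWeyl_ext ?_ (ofIdx_mul_self θ)
    change P.root θ + RootPairing.weylGroup.ofIdx P θ • P.root θ = 0
    rw [ofIdx_smul_eq, P.root_coroot_two]
    module

lemma simpleRefl_inv (i : Option b.support) : (simpleRefl b θ i)⁻¹ = simpleRefl b θ i :=
  inv_eq_of_mul_eq_one_left (simpleRefl_mul_self b θ i)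

lemma act_simpleRefl_simpleXi (i : Option b.support) :
    act P (simpleRefl b θ i) (simpleXi b θ i) = - simpleXi b θ i := by
  cases i with
  | some i =>
    have ht : (simpleRefl b θ (some i)).transl P = 0 := rfl
    have hr : (simpleRefl b θ (some i)).right = RootPairing.weylGroup.ofIdx P i := rfl
    have : P.coroot i - (2 : k) • P.coroot i = -P.coroot i := by module
    rw [simpleXi, act_xi, ht, hr, coweightAct_ofIdx, P.root_coroot_two, this]
    simp
  | none =>
    have ht : (simpleRefl b θ none).transl P = P.root θ := rfl
    have hr : (simpleRefl b θ none).right = RootPairing.weylGroup.ofIdx P θ := rfl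
    have : P.coroot θ - (2 : k) • P.coroot θ = -P.coroot θ := by module
    rw [simpleXi, map_sub, map_one, act_xi, ht, hr, coweightAct_ofIdx, P.root_coroot_two, this,
      map_neg, map_neg, xi_neg, P.root_coroot_two, map_ofNat]
    ring

lemma exists_int_pairing [P.IsCrystallographic] {y : V} (hy : y ∈ RootLattice P) (j : ι) :
    ∃ n : ℤ, P.toLinearMap y (P.coroot j) = n := by
  induction hy using AddSubgroup.closure_induction with
  | mem x hx =>
    obtain ⟨l, rfl⟩ := hx
    obtain ⟨z, hz⟩ := RootPairing.IsValuedIn.exists_value (S := ℤ) (P := P) l j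
    exact ⟨z, by simpa using hz.symm⟩
  | zero => exact ⟨0, by simp⟩
  | add x y _ _ hx hy =>
    obtain ⟨m, hm⟩ := hx
    obtain ⟨n, hn⟩ := hy
    exact ⟨m + n, by rw [map_add, LinearMap.add_apply, hm, hn]; push_cast; rfl⟩
  | neg x _ hx =>
    obtain ⟨m, hm⟩ := hx
    exact ⟨-m, by rw [map_neg, LinearMap.neg_apply, hm]; push_cast; rfl⟩

/-- Every affine Weyl group translate of a simple affine coroot is of the form `ξ_{α^∨} + n`. -/
lemma exists_act_simpleXi [P.IsCrystallographic] (g : AffineWeyl P) (i : Option b.support) :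
    ∃ (j : ι) (n : ℤ), act P g (simpleXi b θ i) = xi P (P.coroot j) + algebraMap k _ (n : k) := by
  have key : ∀ j : ι, ∃ (j' : ι) (n : ℤ),
      act P g (xi P (P.coroot j)) = xi P (P.coroot j') + algebraMap k _ (n : k) := by
    intro j
    obtain ⟨j', hj'⟩ := coweightAct_coroot g.right j
    obtain ⟨n, hn⟩ := exists_int_pairing (Subtype.property (g.left.toAdd)) j'
    refine ⟨j', -n, ?_⟩
    rw [act_xi, hj', AffineWeyl.transl, hn]
    simp [sub_eq_add_neg]
  cases i with
  | some i => exact key i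
  | none =>
    obtain ⟨j, n, hj⟩ := key (P.reflectionPerm θ θ)
    have h1 : P.coroot (P.reflectionPerm θ θ) = - P.coroot θ := by
      simp
    refine ⟨j, n + 1, ?_⟩
    have : simpleXi b θ none = 1 + xi P (P.coroot (P.reflectionPerm θ θ)) := by
      rw [h1, simpleXi, xi_neg]; ring
    rw [this, map_add, map_one, hj]
    rw [Int.cast_add, Int.cast_one, map_add, map_one]
    ring

end Simple

/-! ### Generation of the affine Weyl group by simple reflections -/

section Height

variable [P.IsRootSystem] (b : P.Base)

/-- The point of `X_k` at which all simple coroots take the value one. -/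
def rho : V := P.toPerfPair.symm (b.toCoweightBasis.constr k fun _ => (1 : k))

lemma rho_simple (i : b.support) : P.toLinearMap (rho b) (P.coroot i) = 1 := by
  have h : P.toPerfPair (rho b) = b.toCoweightBasis.constr k fun _ => (1 : k) :=
    P.toPerfPair.apply_symm_apply _
  rw [← b.toCoweightBasis_apply]
  exact (LinearMap.congr_fun h _).trans (b.toCoweightBasis.constr_basis k _ i)

lemma exists_rho_coroot (j : ι) : ∃ c : ℤ, P.toLinearMap (rho b) (P.coroot j) = c := by
  have hj := b.coroot_mem_span_int j
  generalize P.coroot j = x at hj ⊢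
  induction hj using Submodule.span_induction with
  | mem x hx =>
    obtain ⟨i, hi, rfl⟩ := hx
    exact ⟨1, by simpa using rho_simple b ⟨i, hi⟩⟩
  | zero => exact ⟨0, by simp⟩
  | add x y _ _ hx hy =>
    obtain ⟨m, hm⟩ := hx
    obtain ⟨n, hn⟩ := hy
    exact ⟨m + n, by rw [map_add, hm, hn]; push_cast; rfl⟩
  | smul a x _ hx =>
    obtain ⟨m, hm⟩ := hx
    exact ⟨a * m, by rw [map_zsmul, hm]; simp⟩

/-- The height of the coroot with index `j`. -/
def coheight (j : ι) : ℤ := (exists_rho_coroot b j).choose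

lemma rho_coroot (j : ι) : P.toLinearMap (rho b) (P.coroot j) = (coheight b j : k) :=
  (exists_rho_coroot b j).choose_spec

lemma exists_rho_of_mem_closure [CharZero k] {x : V'}
    (hx : x ∈ AddSubmonoid.closure (P.coroot '' b.support)) :
    ∃ n : ℕ, P.toLinearMap (rho b) x = n ∧ (n = 0 → x = 0) := by
  induction hx using AddSubmonoid.closure_induction with
  | mem x hx =>
    obtain ⟨i, hi, rfl⟩ := hx
    exact ⟨1, by simpa using rho_simple b ⟨i, hi⟩, by simp⟩
  | zero => exact ⟨0, by simp, fun _ => rfl⟩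
  | add x y _ _ hx hy =>
    obtain ⟨m, hm, hm'⟩ := hx
    obtain ⟨n, hn, hn'⟩ := hy
    refine ⟨m + n, by rw [map_add, hm, hn]; push_cast; rfl, fun h => ?_⟩
    rw [hm' (by omega), hn' (by omega), add_zero]

variable [CharZero k] {b} {θ : ι} (hθ : IsMaxCoroot b θ)
include hθ

lemma coheight_pos_of_isMaxCoroot : 0 < coheight b θ := by
  have h := hθ (P.reflectionPerm θ θ)
  have h1 : P.coroot θ - P.coroot (P.reflectionPerm θ θ) = (2 : k) • P.coroot θ := by
    simp [two_smul]
  rw [h1] at h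
  obtain ⟨n, hn, hn'⟩ := exists_rho_of_mem_closure b h
  rw [map_smul, rho_coroot, smul_eq_mul] at hn
  have hn2 : 2 * coheight b θ = n := by exact_mod_cast hn
  rcases Nat.eq_zero_or_pos n with h0 | h0
  · have := hn' h0
    rw [smul_eq_zero] at this
    exact absurd (this.resolve_left two_ne_zero) (P.flip.ne_zero θ)
  · omega

/-- The maximal coroot is long: `(θ : β^∨) ≤ 1` for all roots `β ≠ θ`. -/
lemma eq_of_two_le_pairing [P.IsCrystallographic] {j : ι} {n : ℤ} (hn : 2 ≤ n)
    (hj : P.toLinearMap (P.root θ) (P.coroot j) = n) : j = θ := by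
  have h1 : P.coroot (P.reflectionPerm θ (P.reflectionPerm j j))
      = (n : k) • P.coroot θ - P.coroot j := by
    rw [P.coroot_reflectionPerm, P.coreflection_apply]
    simp only [P.coroot_reflectionPerm, P.coreflection_apply_self, map_neg, hj]
    module
  have h2 := hθ (P.reflectionPerm θ (P.reflectionPerm j j))
  have h3 := hθ j
  have hpos := coheight_pos_of_isMaxCoroot hθ
  obtain ⟨m, hm, hm'⟩ := exists_rho_of_mem_closure b h2
  obtain ⟨l, hl, hl'⟩ := exists_rho_of_mem_closure b h3
  rw [h1] at hm
  simp only [map_sub, map_smul, rho_coroot, smul_eq_mul] at hm hl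
  have hm2 : coheight b θ - (n * coheight b θ - coheight b j) = m := by exact_mod_cast hm
  have hl2 : coheight b θ - coheight b j = l := by exact_mod_cast hl
  have : l = 0 := by
    by_contra h0
    have : (0 : ℤ) < l := by omega
    nlinarith
  exact (P.coroot.injective (sub_eq_zero.mp (hl' this))).symm

end Height

section Generation

variable (b : P.Base) (θ : ι)

lemma weyl_ext {w w' : P.weylGroup} (h : ∀ μ : V, w • μ = w' • μ) : w = w' :=
  Subtype.ext (RootPairing.Equiv.weightHom_injective P (LinearEquiv.ext h))

lemma ofIdx_reflectionPerm (i j : ι) :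
    RootPairing.weylGroup.ofIdx P (P.reflectionPerm i j) = RootPairing.weylGroup.ofIdx P i *
      RootPairing.weylGroup.ofIdx P j * RootPairing.weylGroup.ofIdx P i := by
  refine weyl_ext fun μ => ?_
  change P.reflection (P.reflectionPerm i j) μ
    = P.reflection i (P.reflection j (P.reflection i μ))
  rw [P.reflection_reflectionPerm]; rfl

variable [CharZero k] [Finite ι] [P.IsCrystallographic] [P.IsReduced]

lemma inr_mem_closure_simpleRefl (w : P.weylGroup) :
    (SemidirectProduct.inr w : AffineWeyl P) ∈ Subgroup.closure (Set.range (simpleRefl b θ)) := by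
  have hidx : ∀ j, (SemidirectProduct.inr (RootPairing.weylGroup.ofIdx P j) : AffineWeyl P) ∈
      Subgroup.closure (Set.range (simpleRefl b θ)) := by
    intro j
    refine b.induction_reflect (p := fun j =>
      (SemidirectProduct.inr (RootPairing.weylGroup.ofIdx P j) : AffineWeyl P) ∈
        Subgroup.closure (Set.range (simpleRefl b θ))) j (fun i hi => ?_)
      (fun i hi => Subgroup.subset_closure ⟨some ⟨i, hi⟩, rfl⟩) (fun i l hi hl => ?_)
    · rw [ofIdx_reflectionPerm, map_mul, map_mul]
      exact mul_mem (mul_mem hi hi) hi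
    · have : (SemidirectProduct.inr (RootPairing.weylGroup.ofIdx P l) : AffineWeyl P) ∈
        Subgroup.closure (Set.range (simpleRefl b θ)) :=
        Subgroup.subset_closure ⟨some ⟨l, hl⟩, rfl⟩
      rw [ofIdx_reflectionPerm, map_mul, map_mul]
      exact mul_mem (mul_mem this hi) this
  obtain ⟨w, hw⟩ := w
  induction hw using RootPairing.weylGroup.induction with
  | mem i => exact hidx i
  | one =>
    have : (⟨1, one_mem _⟩ : P.weylGroup) = 1 := rfl
    rw [this, map_one]; exact one_mem _
  | mul x y hx hy hx' hy' =>
    have : (⟨x * y, mul_mem hx hy⟩ : P.weylGroup) = ⟨x, hx⟩ * ⟨y, hy⟩ := rfl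
    rw [this, map_mul]; exact mul_mem hx' hy'

variable [P.IsRootSystem] [P.IsIrreducible] {b θ}

/-- The affine Weyl group is generated by the `s_i`, `i ∈ Î`. Since `θ` is short, every root is, up
to sign, either in the Weyl group orbit of `θ` or a difference of two elements of this orbit; so the
translations by this orbit generate all translations. -/
lemma closure_simpleRefl (hθ : IsMaxCoroot b θ) :
    Subgroup.closure (Set.range (simpleRefl b θ)) = ⊤ := by
  set G := Subgroup.closure (Set.range (simpleRefl b θ)) with hG
  let tr : RootLattice P → AffineWeyl P := fun y => SemidirectProduct.inl (Multiplicative.ofAdd y)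
  have tr_add : ∀ y z, tr (y + z) = tr y * tr z := fun y z => by
    simp only [tr, ofAdd_add, map_mul]
  have tr_neg : ∀ y, tr (-y) = (tr y)⁻¹ := fun y => by simp only [tr, ofAdd_neg, map_inv]
  have hθG : ∀ (w : P.weylGroup) (h : w • P.root θ ∈ RootLattice P), tr ⟨w • P.root θ, h⟩ ∈ G := by
    intro w h
    have h0 : tr ⟨P.root θ, AddSubgroup.subset_closure ⟨θ, rfl⟩⟩ =
        simpleRefl b θ none * SemidirectProduct.inr (RootPairing.weylGroup.ofIdx P θ) := by
      refine affineWeyl_ext ?_ (ofIdx_mul_self θ).symm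
      rw [transl_mul]
      change P.root θ = P.root θ + RootPairing.weylGroup.ofIdx P θ • 0
      rw [smul_zero, add_zero]
    have h1 : tr ⟨w • P.root θ, h⟩ = SemidirectProduct.inr w *
        tr ⟨P.root θ, AddSubgroup.subset_closure ⟨θ, rfl⟩⟩ * SemidirectProduct.inr w⁻¹ := by
      simp only [tr]
      rw [← SemidirectProduct.inl_aut]; rfl
    rw [h1, h0]
    exact mul_mem (mul_mem (inr_mem_closure_simpleRefl b θ w)
      (mul_mem (Subgroup.subset_closure ⟨none, rfl⟩) (inr_mem_closure_simpleRefl b θ _)))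
      (inr_mem_closure_simpleRefl b θ _)
  have hroot : ∀ (j : ι) (h : P.root j ∈ RootLattice P), tr ⟨P.root j, h⟩ ∈ G := by
    intro j h
    obtain ⟨w, hw⟩ : ∃ w : P.weylGroup, P.toLinearMap (w • P.root θ) (P.coroot j) ≠ 0 := by
      by_contra! hc
      have h2 : (⊤ : Submodule k V) ≤ LinearMap.ker (P.coroot' j) := by
        rw [← P.span_orbit_eq_top θ, Submodule.span_le]
        rintro _ ⟨w, rfl⟩
        exact hc w
      have h3 : P.root j ∈ LinearMap.ker (P.coroot' j) := h2 trivial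
      have h4 : P.toLinearMap (P.root j) (P.coroot j) = 0 := h3
      rw [P.root_coroot_two] at h4
      exact two_ne_zero h4
    have hmem : ∀ v : P.weylGroup, v • P.root θ ∈ RootLattice P := fun v =>
      smul_mem_rootLattice P v (AddSubgroup.subset_closure ⟨θ, rfl⟩)
    obtain ⟨n, hn⟩ := exists_int_pairing (hmem w) j
    have hn0 : n ≠ 0 := by
      rintro rfl
      exact hw (by simpa using hn)
    obtain ⟨j', hj'⟩ := coweightAct_coroot w⁻¹ j
    have hnj : P.toLinearMap (P.root θ) (P.coroot j') = n := by
      rw [← hj', toLinearMap_coweightAct, inv_inv, hn]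
    -- `w θ - s_j w θ = n α_j`
    have hdiff : w • P.root θ - (RootPairing.weylGroup.ofIdx P j * w) • P.root θ
        = (n : k) • P.root j := by
      rw [mul_smul, ofIdx_smul_eq, hn]; abel
    have hcoroot : ∀ e : k, P.coroot j' = e • P.coroot θ → (e = 1 ∨ e = -1) →
        P.root j = e • (w • P.root θ) := by
      intro e he hee
      have hθ' : ∃ l, w • P.root θ = P.root l := ⟨_, P.weylGroup_apply_root w θ⟩
      obtain ⟨l, hl⟩ := hθ'
      have h5 : coweightAct P w (P.coroot j') = P.coroot j := by
        refine coweight_ext (P := P) fun μ => ?_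
        rw [toLinearMap_coweightAct, ← hj', toLinearMap_coweightAct, inv_inv, smul_inv_smul]
      have h6 : coweightAct P w (P.coroot θ) = P.coroot l := by
        have := RootPairing.Hom.coroot_coweightMap_apply P P θ
          (RootPairing.Equiv.toHom ((w⁻¹ : P.weylGroup) : P.Aut))
        refine this.trans (congrArg P.coroot ?_)
        rw [Equiv.symm_apply_eq]
        refine P.root.injective ?_
        have h7 := RootPairing.Hom.root_weightMap_apply P P l
          (RootPairing.Equiv.toHom ((w⁻¹ : P.weylGroup) : P.Aut))
        rw [← h7]
        change P.root θ = w⁻¹ • P.root l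
        rw [← hl, inv_smul_smul]
      have h8 : P.coroot j = e • P.coroot l := by rw [← h5, he, map_smul, h6]
      rw [hl]
      rcases hee with rfl | rfl
      · rw [one_smul] at h8 ⊢
        rw [P.coroot.injective h8]
      · rw [neg_one_smul] at h8 ⊢
        have : P.coroot j = P.coroot (P.reflectionPerm l l) := by rw [h8]; simp
        rw [P.coroot.injective this]; simp
    rcases lt_trichotomy n 0 with hlt | h0 | hgt
    · rcases eq_or_ne n (-1) with rfl | hne
      · have : (⟨P.root j, h⟩ : RootLattice P) = -⟨_, hmem w⟩ +
            ⟨_, hmem (RootPairing.weylGroup.ofIdx P j * w)⟩ := by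
          refine Subtype.ext ?_
          change P.root j = -(w • P.root θ) + _
          have h9 : P.root j = -((((-1 : ℤ)) : k) • P.root j) := by simp
          rw [h9, ← hdiff]; abel
        rw [this, tr_add, tr_neg]
        exact mul_mem (inv_mem (hθG _ _)) (hθG _ _)
      · have h2 : P.toLinearMap (P.root θ) (P.coroot (P.reflectionPerm j' j')) = ((-n : ℤ) : k) := by
          simp [hnj]
        have h3 := eq_of_two_le_pairing hθ (by omega) h2
        have h4 := hcoroot (-1) (by rw [← h3]; simp) (Or.inr rfl)
        have : (⟨P.root j, h⟩ : RootLattice P) = -⟨_, hmem w⟩ :=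
          Subtype.ext (h4.trans (neg_one_smul _ _))
        rw [this, tr_neg]
        exact inv_mem (hθG _ _)
    · exact absurd h0 hn0
    · rcases eq_or_ne n 1 with rfl | hne
      · have : (⟨P.root j, h⟩ : RootLattice P) = ⟨_, hmem w⟩ +
            -⟨_, hmem (RootPairing.weylGroup.ofIdx P j * w)⟩ := by
          refine Subtype.ext ?_
          change P.root j = w • P.root θ + -_
          rw [← sub_eq_add_neg, hdiff]; simp
        rw [this, tr_add, tr_neg]
        exact mul_mem (hθG _ _) (inv_mem (hθG _ _))
      · have h3 := eq_of_two_le_pairing hθ (by omega) hnj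
        have h4 := hcoroot 1 (by rw [h3, one_smul]) (Or.inl rfl)
        have : (⟨P.root j, h⟩ : RootLattice P) = ⟨_, hmem w⟩ :=
          Subtype.ext (h4.trans (one_smul _ _))
        rw [this]
        exact hθG _ _
  have hall : ∀ (y : V) (hy : y ∈ RootLattice P), tr ⟨y, hy⟩ ∈ G := by
    intro y hy
    induction hy using AddSubgroup.closure_induction with
    | mem x hx =>
      obtain ⟨j, rfl⟩ := hx
      exact hroot j _
    | zero => exact one_mem G
    | add x y hx hy hx' hy' =>
      have := tr_add ⟨x, hx⟩ ⟨y, hy⟩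
      exact this ▸ mul_mem hx' hy'
    | neg x hx hx' =>
      have := tr_neg ⟨x, hx⟩
      exact this ▸ inv_mem hx'
  rw [eq_top_iff]
  intro g _
  rw [← SemidirectProduct.inl_left_mul_inr_right g]
  exact mul_mem (hall _ g.left.toAdd.2) (inr_mem_closure_simpleRefl b θ _)

end Generation

/-! ### A descent function on the affine Weyl group -/

section Descent

variable {b : P.Base} {θ : ι}

/-- A nonnegative combination of simple coroots is bounded below where the simple coroots are. The
field `k` has no order, so the inequality is stated for integers whose images are the values
multiplied by a common scale `s`. -/
lemma exists_lower_bound {x : V'} (hx : x ∈ AddSubmonoid.closure (P.coroot '' b.support)) :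
    ∃ K : ℤ, 0 ≤ K ∧ ∀ (s : k) (C : ℤ) (y : V),
      (∀ i : b.support, ∃ T : ℤ, s * P.toLinearMap y (P.coroot i) = T ∧ -C ≤ T) →
      ∃ n : ℤ, s * P.toLinearMap y x = n ∧ -(K * C) ≤ n := by
  induction hx using AddSubmonoid.closure_induction with
  | mem x hx =>
    obtain ⟨i, hi, rfl⟩ := hx
    refine ⟨1, zero_le_one, fun s C y h => ?_⟩
    simpa using h ⟨i, hi⟩
  | zero => exact ⟨0, le_rfl, fun s C y h => ⟨0, by simp, by simp⟩⟩
  | add x x' _ _ hx hx' =>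
    obtain ⟨K, hK, h⟩ := hx
    obtain ⟨K', hK', h'⟩ := hx'
    refine ⟨K + K', add_nonneg hK hK', fun s C y hy => ?_⟩
    obtain ⟨n, hn, hn'⟩ := h s C y hy
    obtain ⟨m, hm, hm'⟩ := h' s C y hy
    refine ⟨n + m, ?_, by linarith⟩
    rw [map_add, mul_add, hn, hm]
    push_cast; rfl

lemma two_mul_rootForm_simpleRoot [Fintype ι] (μ μ' : V) (i : Option b.support) :
    2 * P.RootForm (μ - μ') (simpleRoot b θ i) =
      (evalAt P μ (simpleXi b θ i) - evalAt P μ' (simpleXi b θ i)) *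
        P.RootForm (simpleRoot b θ i) (simpleRoot b θ i) := by
  have key : ∀ (x : V) (j : ι), 2 * P.RootForm x (P.root j)
      = P.toLinearMap x (P.coroot j) * P.RootForm (P.root j) (P.root j) := by
    intro x j
    have h := congrArg (P.toLinearMap x) (P.rootForm_self_smul_coroot j)
    rw [map_smul, map_nsmul, P.toLinearMap_apply_apply_Polarization, nsmul_eq_mul, smul_eq_mul] at h
    rw [mul_comm (P.toLinearMap x _), h]
    have h' : P.RootForm (P.root j) x = P.RootForm x (P.root j) := P.rootForm_symmetric.eq _ _
    simp [h']
  cases i with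
  | some i =>
    change 2 * P.RootForm (μ - μ') (P.root i) = _ * P.RootForm (P.root i) (P.root i)
    rw [key, simpleXi, evalAt_xi, evalAt_xi, map_sub, LinearMap.sub_apply]
  | none =>
    change 2 * P.RootForm (μ - μ') (-P.root θ) = _ * P.RootForm (-P.root θ) (-P.root θ)
    have h1 := key (μ - μ') θ
    simp only [map_sub, LinearMap.sub_apply] at h1
    simp only [map_neg, LinearMap.neg_apply, simpleXi, map_sub, map_one, evalAt_xi,
      LinearMap.sub_apply]
    linear_combination -h1

lemma exists_rootForm_simpleRoot_pos [CharZero k] [P.IsCrystallographic] [Fintype ι]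
    (i : Option b.support) :
    ∃ z : ℤ, 0 < z ∧ P.RootForm (simpleRoot b θ i) (simpleRoot b θ i) = z := by
  have key : ∀ j : ι, ∃ z : ℤ, 0 < z ∧ P.RootForm (P.root j) (P.root j) = z := by
    intro j
    refine ⟨∑ i, P.pairingIn ℤ j i * P.pairingIn ℤ j i, ?_, ?_⟩
    · refine Finset.sum_pos' (fun i _ => mul_self_nonneg _) ⟨j, Finset.mem_univ _, ?_⟩
      rw [P.pairingIn_same]; norm_num
    · rw [P.rootForm_root_self]
      push_cast
      refine Finset.sum_congr rfl fun i _ => ?_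
      have : P.pairing j i = (P.pairingIn ℤ j i : k) := (P.algebraMap_pairingIn ℤ j i).symm
      rw [this]
  cases i with
  | some i => exact key i
  | none =>
    obtain ⟨z, hz, h⟩ := key θ
    refine ⟨z, hz, ?_⟩
    rw [← h]
    simp [simpleRoot]

variable [CharZero k] [P.IsRootSystem]

/-- The integer `1 + ht θ^∨`, by which the values of the simple affine coroots on the orbit of
`alcovePoint` are multiplied to become integers. -/
def alcoveScale (b : P.Base) (θ : ι) : ℤ := coheight b θ + 1

/-- The point `x₀` of the fundamental alcove, that is, `ξ_{α_i^∨}(x₀) > 0` for `i ∈ Î`: all the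
simple affine coroots take the value `(1 + ht θ^∨)⁻¹` at `x₀`. -/
def alcovePoint (b : P.Base) (θ : ι) : V := (alcoveScale b θ : k)⁻¹ • rho b

lemma alcoveScale_ne_zero (hθ : IsMaxCoroot b θ) : (alcoveScale b θ : k) ≠ 0 := by
  have := coheight_pos_of_isMaxCoroot hθ
  rw [Int.cast_ne_zero, alcoveScale]
  omega

lemma scale_mul_alcovePoint (hθ : IsMaxCoroot b θ) (j : ι) :
    (alcoveScale b θ : k) * P.toLinearMap (alcovePoint b θ) (P.coroot j) = coheight b j := by
  rw [alcovePoint, map_smul, LinearMap.smul_apply, rho_coroot, smul_eq_mul,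
    mul_inv_cancel_left₀ (alcoveScale_ne_zero hθ)]

lemma simpleXi_alcovePoint_pos (hθ : IsMaxCoroot b θ) (i : Option b.support) :
    ∃ t : ℤ, 0 < t ∧ (alcoveScale b θ : k) * evalAt P (alcovePoint b θ) (simpleXi b θ i) = t := by
  cases i with
  | some i =>
    refine ⟨1, one_pos, ?_⟩
    rw [simpleXi, evalAt_xi, scale_mul_alcovePoint hθ, ← rho_coroot, rho_simple, Int.cast_one]
  | none =>
    refine ⟨1, one_pos, ?_⟩
    rw [simpleXi, map_sub, map_one, evalAt_xi, mul_sub, scale_mul_alcovePoint hθ, alcoveScale]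
    push_cast
    ring

/-- Only finitely many alcoves satisfy a lower bound for all simple affine coroots, because a
positive combination of these, involving all of them, is constant. -/
lemma finite_setOf_le_simpleXi [Finite ι] (hθ : IsMaxCoroot b θ) (C : ℤ) :
    {g : AffineWeyl P | ∀ i : Option b.support, ∃ t : ℤ,
      (alcoveScale b θ : k) * evalAt P (g • alcovePoint b θ) (simpleXi b θ i) = t ∧
        -C ≤ t}.Finite := by
  choose K hK0 hK using fun i : b.support => exists_lower_bound (hθ i)
  have hs := alcoveScale_ne_zero hθ
  let A : b.support → Set k := fun i =>
    (fun n : ℤ => (alcoveScale b θ : k)⁻¹ * n) ''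
      Set.Icc (-C) (alcoveScale b θ + C + K i * C)
  have hA : ∀ i, (A i).Finite := fun i => (Set.finite_Icc _ _).image _
  refine (finite_setOf_smul_mem (alcovePoint b θ) (finite_setOf_simple_pairing_mem b hA)).subset ?_
  intro g hg i
  have hsimple : ∀ i : b.support, ∃ T : ℤ,
      (alcoveScale b θ : k) * P.toLinearMap (g • alcovePoint b θ) (P.coroot i) = T ∧ -C ≤ T := by
    intro i
    obtain ⟨t, ht, ht'⟩ := hg (some i)
    exact ⟨t, by rwa [simpleXi, evalAt_xi] at ht, ht'⟩
  obtain ⟨T, hT, hT'⟩ := hsimple i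
  obtain ⟨t, ht, ht'⟩ := hg none
  obtain ⟨n, hn, hn'⟩ := hK i _ C _ hsimple
  refine ⟨T, ⟨hT', ?_⟩, ?_⟩
  · have h1 : T = alcoveScale b θ - t - n := by
      apply Int.cast_injective (α := k)
      push_cast
      rw [← hT, ← ht, ← hn, simpleXi, map_sub, map_one, evalAt_xi, map_sub]
      ring
    linarith
  · simp only
    rw [← hT, inv_mul_cancel_left₀ hs]

variable [P.IsCrystallographic]

lemma exists_scale_smul_alcovePoint (hθ : IsMaxCoroot b θ) (g : AffineWeyl P) (j : ι) :
    ∃ z : ℤ, (alcoveScale b θ : k) *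
      P.toLinearMap (g • alcovePoint b θ - alcovePoint b θ) (P.coroot j) = z := by
  obtain ⟨j', hj'⟩ := coweightAct_coroot g.right⁻¹ j
  have h1 : P.toLinearMap (g.right • alcovePoint b θ) (P.coroot j)
      = P.toLinearMap (alcovePoint b θ) (P.coroot j') := by
    rw [← hj', toLinearMap_coweightAct, inv_inv]
  obtain ⟨n, hn⟩ := exists_int_pairing (Subtype.property g.left.toAdd) j
  refine ⟨alcoveScale b θ * n + coheight b j' - coheight b j, ?_⟩
  rw [smul_def, map_sub, map_add, LinearMap.sub_apply, LinearMap.add_apply, h1,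
    AffineWeyl.transl, hn, mul_sub, mul_add, scale_mul_alcovePoint hθ, scale_mul_alcovePoint hθ]
  push_cast
  ring

lemma exists_scale_mul_simpleXi (hθ : IsMaxCoroot b θ) (g : AffineWeyl P) (i : Option b.support) :
    ∃ (t : ℤ) (j : ι) (n : ℤ),
      (alcoveScale b θ : k) * evalAt P (g • alcovePoint b θ) (simpleXi b θ i) = t ∧
      act P g⁻¹ (simpleXi b θ i) = xi P (P.coroot j) + algebraMap k _ (n : k) ∧
      t = coheight b j + alcoveScale b θ * n := by
  obtain ⟨j, n, hj⟩ := exists_act_simpleXi b θ g⁻¹ i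
  refine ⟨_, j, n, ?_, hj, rfl⟩
  have h1 : evalAt P (g • alcovePoint b θ) (simpleXi b θ i)
      = evalAt P (alcovePoint b θ) (act P g⁻¹ (simpleXi b θ i)) := by
    rw [evalAt_act, inv_inv]
  rw [h1, hj, map_add, evalAt_xi, AlgHom.commutes, mul_add, scale_mul_alcovePoint hθ]
  simp

variable [Finite ι]

variable (b θ) in
/-- `f(g)` is a multiple of the square of the distance between `g x₀` and `x₀`, for an invariant
scalar product and the point `x₀` of the fundamental alcove. -/
def alcoveDist (hθ : IsMaxCoroot b θ) (g : AffineWeyl P) : ℤ :=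
  letI := Fintype.ofFinite ι
  ∑ j, (exists_scale_smul_alcovePoint hθ g j).choose ^ 2

lemma alcoveDist_nonneg (hθ : IsMaxCoroot b θ) (g : AffineWeyl P) : 0 ≤ alcoveDist b θ hθ g :=
  Finset.sum_nonneg fun _ _ => sq_nonneg _

lemma cast_alcoveDist [Fintype ι] (hθ : IsMaxCoroot b θ) (g : AffineWeyl P) :
    (alcoveDist b θ hθ g : k) = (alcoveScale b θ : k) ^ 2 *
      P.RootForm (g • alcovePoint b θ - alcovePoint b θ) (g • alcovePoint b θ - alcovePoint b θ) := by
  rw [P.rootForm_apply_apply, Finset.mul_sum, alcoveDist, Int.cast_sum]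
  refine Finset.sum_congr (by congr!) fun j _ => ?_
  rw [Int.cast_pow, ← (exists_scale_smul_alcovePoint hθ g j).choose_spec]
  change _ = _ * (P.toLinearMap _ (P.coroot j) * P.toLinearMap _ (P.coroot j))
  ring

/-- Reflecting in a wall which separates `g x₀` from `x₀` brings it closer to `x₀`. -/
lemma alcoveDist_simpleRefl_mul_lt (hθ : IsMaxCoroot b θ) (g : AffineWeyl P) (i : Option b.support)
    {t : ℤ} (ht : (alcoveScale b θ : k) * evalAt P (g • alcovePoint b θ) (simpleXi b θ i) = t)
    (ht0 : t < 0) : alcoveDist b θ hθ (simpleRefl b θ i * g) < alcoveDist b θ hθ g := by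
  let _ := Fintype.ofFinite ι
  obtain ⟨z, hz, hβ⟩ := exists_rootForm_simpleRoot_pos (θ := θ) i
  obtain ⟨t₀, ht₀, h₀⟩ := simpleXi_alcovePoint_pos hθ i
  have key : alcoveDist b θ hθ (simpleRefl b θ i * g) = alcoveDist b θ hθ g + t * t₀ * z := by
    apply Int.cast_injective (α := k)
    push_cast
    rw [cast_alcoveDist, cast_alcoveDist, ← ht, ← h₀, ← hβ, mul_smul, simpleRefl_smul]
    have h2 := two_mul_rootForm_simpleRoot (θ := θ) (g • alcovePoint b θ) (alcovePoint b θ) i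
    set y := g • alcovePoint b θ
    set x := alcovePoint b θ
    set β := simpleRoot b θ i
    set a := evalAt P y (simpleXi b θ i)
    have h3 : y - a • β - x = (y - x) - a • β := by abel
    have h4 : P.RootForm β (y - x) = P.RootForm (y - x) β := (P.rootForm_symmetric).eq _ _
    rw [h3]
    simp only [map_sub (P.RootForm) (y - x), map_sub _ (y - x), map_smul, LinearMap.sub_apply _ _,
      LinearMap.smul_apply, smul_eq_mul, h4]
    linear_combination (-(alcoveScale b θ : k) ^ 2 * a) * h2
  rw [key]
  have : 0 < t₀ * z := mul_pos ht₀ hz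
  nlinarith

end Descent

/-! ### Ideals of finite codimension -/

section PolynomialIdeals

lemma evalAt_surjective (μ : V) : Function.Surjective (evalAt P μ) := fun c =>
  ⟨algebraMap k _ c, AlgHom.commutes _ c⟩

instance isMaximal_maxIdeal (μ : V) : (maxIdeal P μ).IsMaximal :=
  RingHom.ker_isMaximal_of_surjective (evalAt P μ) (evalAt_surjective μ)

lemma mem_maxIdeal {μ : V} {p : SPrime P} : p ∈ maxIdeal P μ ↔ evalAt P μ p = 0 := Iff.rfl

lemma invIdeal_le_maxIdeal (μ : V) : invIdeal P μ ≤ maxIdeal P μ :=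
  Ideal.span_le.mpr fun _ hp => hp.1

lemma act_mem_invIdeal (g : AffineWeyl P) {μ : V} {p : SPrime P} (hp : p ∈ invIdeal P μ) :
    act P g p ∈ invIdeal P (g • μ) := by
  suffices invIdeal P μ ≤ (invIdeal P (g • μ)).comap (act P g) from this hp
  refine Ideal.span_le.mpr fun q hq => Ideal.subset_span ⟨?_, fun s hs => ?_⟩
  · change evalAt P (g • μ) (act P g q) = 0
    rw [evalAt_smul_act]; exact hq.1
  · have h1 : g⁻¹ * s * g ∈ MulAction.stabilizer (AffineWeyl P) μ := by
      rw [MulAction.mem_stabilizer_iff] at hs ⊢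
      rw [mul_smul, mul_smul, hs, inv_smul_smul]
    have h2 := congrArg (act P g) (hq.2 _ h1)
    rw [← act_mul_apply] at h2
    rw [← act_mul_apply, ← h2]
    congr 1
    rw [← mul_assoc, ← mul_assoc, mul_inv_cancel, one_mul]

variable [P.IsRootSystem]

lemma maxIdeal_injective : Function.Injective (maxIdeal P : V → Ideal (SPrime P)) := by
  intro μ μ' h
  refine weight_ext (P := P) fun j => ?_
  have h1 : xi P (P.coroot j) - algebraMap k _ (P.toLinearMap μ (P.coroot j)) ∈ maxIdeal P μ := by
    rw [mem_maxIdeal, map_sub, evalAt_xi, AlgHom.commutes]; exact sub_self _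
  rw [h, mem_maxIdeal, map_sub, evalAt_xi, AlgHom.commutes] at h1
  exact (sub_eq_zero.mp h1).symm

variable [Finite ι]

include P in
variable (P) in
lemma finiteType_sPrime : Algebra.FiniteType k (SPrime P) := by
  have : Module.Finite k V' := ⟨Submodule.fg_def.mpr
    ⟨_, Set.finite_range P.coroot, RootPairing.IsRootSystem.span_coroot_eq_top⟩⟩
  let B := Module.finBasis k V'
  exact Algebra.FiniteType.equiv inferInstance (SymmetricAlgebra.equivMvPolynomial B).symm

/-- An element `p` of `⟨μ⟩` is a root of the monic polynomial `∏ (T - ᵍp)`, the product over the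
stabilizer of `μ`, whose lower coefficients are invariant and belong to `⟨μ⟩`. -/
lemma maxIdeal_le_radical_invIdeal (μ : V) : maxIdeal P μ ≤ (invIdeal P μ).radical := by
  intro p hp
  let S := MulAction.stabilizer (AffineWeyl P) μ
  let _ := Fintype.ofFinite S
  let f : Polynomial (SPrime P) := ∏ g : S, (Polynomial.X - Polynomial.C (act P (g : AffineWeyl P) p))
  have hf : f.Monic := Polynomial.monic_prod_of_monic _ _ fun _ _ => Polynomial.monic_X_sub_C _
  have hinv : ∀ s ∈ S, f.map (act P s : SPrime P →+* SPrime P) = f := by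
    intro s hs
    rw [Polynomial.map_prod]
    refine Fintype.prod_equiv (Equiv.mulLeft (⟨s, hs⟩ : S)) _ _ fun g => ?_
    simp [act_mul_apply]
  have heval : f.map (evalAt P μ : SPrime P →+* k) = Polynomial.X ^ Fintype.card S := by
    rw [Polynomial.map_prod, Finset.prod_congr rfl (g := fun _ => Polynomial.X), Finset.prod_const,
      Finset.card_univ]
    intro g _
    have h1 : evalAt P μ (act P (g : AffineWeyl P) p) = 0 := by
      rw [evalAt_act, MulAction.mem_stabilizer_iff.mp (inv_mem g.2)]; exact hp
    simp [h1]
  have hdeg : f.natDegree = Fintype.card S := by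
    rw [← hf.natDegree_map (evalAt P μ : SPrime P →+* k), heval, Polynomial.natDegree_X_pow]
  have hcoeff : ∀ i < f.natDegree, f.coeff i ∈ invIdeal P μ := by
    intro i hi
    refine Ideal.subset_span ⟨?_, fun s hs => ?_⟩
    · have h1 := congrArg (fun q => Polynomial.coeff q i) heval
      simp only [Polynomial.coeff_map, Polynomial.coeff_X_pow] at h1
      rw [if_neg (by omega)] at h1
      exact h1
    · have h1 := congrArg (fun q => Polynomial.coeff q i) (hinv s hs)
      rw [Polynomial.coeff_map] at h1
      exact h1
  refine ⟨f.natDegree, ?_⟩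
  have hroot : f.eval p = 0 := by
    rw [Polynomial.eval_prod]
    refine Finset.prod_eq_zero (Finset.mem_univ (1 : S)) ?_
    simp [act_one_apply]
  rw [Polynomial.eval_eq_sum_range, Finset.sum_range_succ, hf.coeff_natDegree, one_mul] at hroot
  rw [eq_neg_of_add_eq_zero_right hroot, neg_mem_iff]
  exact Ideal.sum_mem _ fun i hi => Ideal.mul_mem_right _ _ (hcoeff i (Finset.mem_range.mp hi))

lemma radical_invIdeal (μ : V) : (invIdeal P μ).radical = maxIdeal P μ :=
  le_antisymm ((isMaximal_maxIdeal μ).isPrime.radical_le_iff.mpr (invIdeal_le_maxIdeal μ))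
    (maxIdeal_le_radical_invIdeal μ)

lemma isPrimary_invIdeal (μ : V) : (invIdeal P μ).IsPrimary :=
  Ideal.isPrimary_of_isMaximal_radical (by rw [radical_invIdeal]; infer_instance)

lemma isCoprime_invIdeal {μ μ' : V} (h : μ ≠ μ') : IsCoprime (invIdeal P μ) (invIdeal P μ') := by
  rw [Ideal.isCoprime_iff_sup_eq, ← Ideal.radical_eq_top, Ideal.radical_sup, radical_invIdeal,
    radical_invIdeal, Ideal.radical_eq_top]
  exact Ideal.IsMaximal.coprime_of_ne inferInstance inferInstance fun h' => h (maxIdeal_injective h')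

instance finite_quotient_invIdeal (μ : V) : Module.Finite k (SPrime P ⧸ invIdeal P μ) := by
  have := finiteType_sPrime P
  have : Algebra.FiniteType k (SPrime P ⧸ invIdeal P μ) :=
    Algebra.FiniteType.of_surjective (Ideal.Quotient.mkₐ k _) (Ideal.Quotient.mkₐ_surjective k _)
  have : Algebra.IsIntegral k (SPrime P ⧸ invIdeal P μ) := by
    refine ⟨fun x => ?_⟩
    obtain ⟨p, rfl⟩ := Ideal.Quotient.mk_surjective x
    have h1 : p - algebraMap k _ (evalAt P μ p) ∈ maxIdeal P μ := by
      rw [mem_maxIdeal, map_sub, AlgHom.commutes]; exact sub_self _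
    obtain ⟨n, hn⟩ := maxIdeal_le_radical_invIdeal μ h1
    refine ⟨(Polynomial.X - Polynomial.C (evalAt P μ p)) ^ n,
      (Polynomial.monic_X_sub_C _).pow n, ?_⟩
    rw [Polynomial.eval₂_pow, Polynomial.eval₂_sub, Polynomial.eval₂_X, Polynomial.eval₂_C]
    rw [← Ideal.Quotient.eq_zero_iff_mem, map_pow, map_sub] at hn
    exact hn
  exact Algebra.IsIntegral.finite

lemma exists_maxIdeal_pow_le (μ : V) : ∃ n, maxIdeal P μ ^ n ≤ invIdeal P μ := by
  have := finiteType_sPrime P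
  have : IsNoetherianRing (SPrime P) := Algebra.FiniteType.isNoetherianRing k _
  exact Ideal.exists_pow_le_of_le_radical_of_fg (maxIdeal_le_radical_invIdeal μ)
    (IsNoetherian.noetherian _)

end PolynomialIdeals

section Codimension

/-- The translate `ᵍI` of an ideal of `S'`. -/
def twist (g : AffineWeyl P) (I : Ideal (SPrime P)) : Ideal (SPrime P) := I.comap (act P g⁻¹)

lemma mem_twist {g : AffineWeyl P} {I : Ideal (SPrime P)} {p : SPrime P} :
    p ∈ twist g I ↔ act P g⁻¹ p ∈ I := Iff.rfl

lemma act_mem_twist {g : AffineWeyl P} {I : Ideal (SPrime P)} {p : SPrime P} (hp : p ∈ I) :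
    act P g p ∈ twist g I := by rwa [mem_twist, act_inv_act]

lemma act_mem_twist_mul {g g' : AffineWeyl P} {I : Ideal (SPrime P)} {p : SPrime P}
    (hp : p ∈ twist g' I) : act P g p ∈ twist (g * g') I := by
  rwa [mem_twist, mul_inv_rev, act_mul_apply, act_inv_act]

lemma twist_invIdeal (g : AffineWeyl P) (μ : V) :
    twist g (invIdeal P μ) = invIdeal P (g • μ) := by
  ext p
  refine ⟨fun hp => ?_, fun hp => ?_⟩
  · have := act_mem_invIdeal g hp
    rwa [act_act_inv] at this
  · have := act_mem_invIdeal g⁻¹ hp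
    rwa [inv_smul_smul] at this

instance finite_quotient_twist (g : AffineWeyl P) (I : Ideal (SPrime P))
    [Module.Finite k (SPrime P ⧸ I)] : Module.Finite k (SPrime P ⧸ twist g I) :=
  Module.Finite.of_injective
    (Ideal.quotientMapₐ (I := twist g I) I (act P g⁻¹) le_rfl).toLinearMap
    (Ideal.quotientMap_injective (I := I) (f := (act P g⁻¹ : SPrime P →+* SPrime P)))

lemma finite_quotient_of_le {A : Type*} [CommRing A] [Algebra k A] {I J : Ideal A} (h : I ≤ J)
    [Module.Finite k (A ⧸ I)] : Module.Finite k (A ⧸ J) :=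
  Module.Finite.of_surjective (Ideal.Quotient.factorₐ k h).toLinearMap
    (Ideal.Quotient.factor_surjective h)

lemma finite_quotient_inf {A : Type*} [CommRing A] [Algebra k A] (I J : Ideal A)
    [Module.Finite k (A ⧸ I)] [Module.Finite k (A ⧸ J)] : Module.Finite k (A ⧸ (I ⊓ J)) := by
  refine Module.Finite.of_injective
    ((Ideal.Quotient.factorₐ k (inf_le_left : I ⊓ J ≤ I)).toLinearMap.prod
      (Ideal.Quotient.factorₐ k (inf_le_right : I ⊓ J ≤ J)).toLinearMap) ?_
  rw [injective_iff_map_eq_zero]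
  intro x hx
  obtain ⟨a, rfl⟩ := Ideal.Quotient.mk_surjective x
  obtain ⟨h1, h2⟩ := Prod.mk.inj hx
  exact Ideal.Quotient.eq_zero_iff_mem.mpr
    ⟨Ideal.Quotient.eq_zero_iff_mem.mp h1, Ideal.Quotient.eq_zero_iff_mem.mp h2⟩

lemma finite_quotient_finset_inf {A κ : Type*} [CommRing A] [Algebra k A] (s : Finset κ)
    (I : κ → Ideal A) (hI : ∀ i ∈ s, Module.Finite k (A ⧸ I i)) :
    Module.Finite k (A ⧸ ⨅ i ∈ s, I i) := by
  classical
  induction s using Finset.induction_on with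
  | empty =>
    have : Subsingleton (A ⧸ ⨅ i ∈ (∅ : Finset κ), I i) := by
      rw [Ideal.Quotient.subsingleton_iff]; simp
    infer_instance
  | insert a s _ ih =>
    rw [Finset.iInf_insert]
    have := hI a (Finset.mem_insert_self _ _)
    have := ih fun i hi => hI i (Finset.mem_insert_of_mem hi)
    exact finite_quotient_inf _ _

lemma exists_polynomial_coroot [Finite ι] (I : Ideal (SPrime P)) [Module.Finite k (SPrime P ⧸ I)] :
    ∃ f : Polynomial k, f ≠ 0 ∧ ∀ j, Polynomial.aeval (xi P (P.coroot j)) f ∈ I := by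
  let _ := Fintype.ofFinite ι
  let x : ι → SPrime P ⧸ I := fun j => Ideal.Quotient.mkₐ k I (xi P (P.coroot j))
  refine ⟨∏ j, minpoly k (x j), ?_, fun j => ?_⟩
  · exact Finset.prod_ne_zero_iff.mpr fun j _ => minpoly.ne_zero (Algebra.IsIntegral.isIntegral _)
  · rw [← Ideal.Quotient.eq_zero_iff_mem]
    change Ideal.Quotient.mkₐ k I _ = 0
    rw [← Polynomial.aeval_algHom_apply, map_prod]
    exact Finset.prod_eq_zero (Finset.mem_univ j) (minpoly.aeval k (x j))

lemma finite_setOf_not_isCoprime_comp {p q : Polynomial k} (hp : p ≠ 0) (hq : q ≠ 0) :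
    {c : k | ¬ IsCoprime (p.comp (Polynomial.X - Polynomial.C c)) q}.Finite := by
  let K := AlgebraicClosure k
  have hfin : {z : K | ∃ a ∈ (q.rootSet K), ∃ a' ∈ (p.rootSet K), z = a - a'}.Finite := by
    refine (((q.rootSet_finite K).prod (p.rootSet_finite K)).image fun x => x.1 - x.2).subset ?_
    rintro z ⟨a, ha, a', ha', rfl⟩
    exact ⟨(a, a'), ⟨ha, ha'⟩, rfl⟩
  refine (hfin.preimage (algebraMap k K).injective.injOn).subset fun c hc => ?_
  change ¬ _ at hc
  rw [Polynomial.isCoprime_iff_aeval_ne_zero_of_isAlgClosed k K] at hc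
  push Not at hc
  obtain ⟨a, ha, ha'⟩ := hc
  refine ⟨a, Polynomial.mem_rootSet.mpr ⟨hq, ha'⟩, a - algebraMap k K c,
    Polynomial.mem_rootSet.mpr ⟨hp, ?_⟩, by abel⟩
  rw [Polynomial.aeval_comp] at ha
  simpa using ha

/-- Modulo `I` and modulo `J` the coroots have finitely many eigenvalues, and a translation by `y`
shifts those of `α^∨` by `(y : α^∨)`; so `ᵍI` and `J` can fail to be comaximal only for finitely many
translation parts of `g`. -/
lemma finite_setOf_twist_sup_ne_top [Finite ι] [P.IsRootSystem] (I J : Ideal (SPrime P))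
    [Module.Finite k (SPrime P ⧸ I)] [Module.Finite k (SPrime P ⧸ J)] :
    {g : AffineWeyl P | twist g I ⊔ J ≠ ⊤}.Finite := by
  obtain ⟨p, hp, hpI⟩ := exists_polynomial_coroot I
  obtain ⟨q, hq, hqJ⟩ := exists_polynomial_coroot J
  refine (finite_setOf_transl_mem (P := P) (finite_setOf_not_isCoprime_comp hp hq)).subset
    fun g hg j => ?_
  intro hcop
  apply hg
  obtain ⟨j', hj'⟩ := coweightAct_coroot g.right⁻¹ j
  have hj : coweightAct P g.right (P.coroot j') = P.coroot j := by
    refine coweight_ext (P := P) fun μ => ?_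
    rw [toLinearMap_coweightAct, ← hj', toLinearMap_coweightAct, inv_inv, smul_inv_smul]
  have h1 : Polynomial.aeval (xi P (P.coroot j)) (p.comp (Polynomial.X - Polynomial.C
      (P.toLinearMap (g.transl P) (P.coroot j)))) ∈ twist g I := by
    have h2 := act_mem_twist (g := g) (hpI j')
    rw [← Polynomial.aeval_algHom_apply, act_xi, hj] at h2
    rw [Polynomial.aeval_comp]
    simpa using h2
  obtain ⟨u, v, huv⟩ := hcop
  rw [Ideal.eq_top_iff_one]
  have h3 := congrArg (Polynomial.aeval (xi P (P.coroot j))) huv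
  rw [map_add, map_mul, map_mul, map_one] at h3
  rw [← h3]
  exact Submodule.add_mem_sup (Ideal.mul_mem_left _ _ h1) (Ideal.mul_mem_left _ _ (hqJ j))

lemma finite_setOf_span_sup_ne_top [CharZero k] [Finite ι] (J : Ideal (SPrime P))
    [Module.Finite k (SPrime P ⧸ J)] (j : ι) (c : k) :
    {n : ℤ | Ideal.span {(xi P (P.coroot j) + algebraMap k _ (n : k)) ^ 2
      - algebraMap k _ (c ^ 2)} ⊔ J ≠ ⊤}.Finite := by
  obtain ⟨q, hq, hqJ⟩ := exists_polynomial_coroot J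
  let p : Polynomial k := Polynomial.X ^ 2 - Polynomial.C (c ^ 2)
  have hp : p ≠ 0 := (Polynomial.monic_X_pow_sub_C _ two_ne_zero).ne_zero
  have hinj : Function.Injective fun n : ℤ => -(n : k) := fun m n h => by simpa using h
  refine ((finite_setOf_not_isCoprime_comp hp hq).preimage hinj.injOn).subset fun n hn => ?_
  intro hcop
  apply hn
  obtain ⟨u, v, huv⟩ := hcop
  rw [Ideal.eq_top_iff_one]
  have h3 := congrArg (Polynomial.aeval (xi P (P.coroot j))) huv
  rw [map_add, map_mul, map_mul, map_one] at h3
  rw [← h3]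
  refine Submodule.add_mem_sup (Ideal.mul_mem_left _ _ ?_) (Ideal.mul_mem_left _ _ (hqJ j))
  convert Ideal.mem_span_singleton_self _ using 1
  rw [Polynomial.aeval_comp]
  simp [p]

end Codimension

/-! ### Divided differences -/

section DividedDifferences

variable [CharZero k] (b : P.Base) (θ : ι)

lemma simpleXi_ne_zero (i : Option b.support) : simpleXi b θ i ≠ 0 := by
  intro h0
  cases i with
  | some i =>
    have h1 := congrArg (evalAt P (P.root i)) h0
    rw [simpleXi, evalAt_xi, P.root_coroot_two, map_zero] at h1
    exact two_ne_zero h1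
  | none =>
    have h1 := congrArg (evalAt P 0) h0
    rw [simpleXi, map_sub, map_one, evalAt_xi] at h1
    simp at h1

lemma divDiff_eq {i : Option b.support} {p q : SPrime P}
    (hq : simpleXi b θ i * q = p - act P (simpleRefl b θ i) p) : divDiff b θ i p = q :=
  mul_left_cancel₀ (simpleXi_ne_zero b θ i) ((simpleXi_mul_divDiff b θ i p).trans hq.symm)

lemma divDiff_simpleXi_mul (i : Option b.support) (p : SPrime P) :
    divDiff b θ i (simpleXi b θ i * p) = p + act P (simpleRefl b θ i) p :=
  divDiff_eq b θ (by rw [map_mul, act_simpleRefl_simpleXi]; ring)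

lemma divDiff_add (i : Option b.support) (p q : SPrime P) :
    divDiff b θ i (p + q) = divDiff b θ i p + divDiff b θ i q :=
  divDiff_eq b θ (by rw [mul_add, simpleXi_mul_divDiff, simpleXi_mul_divDiff, map_add]; ring)

lemma divDiff_mul_of_act_eq (i : Option b.support) (p : SPrime P) {q : SPrime P}
    (hq : act P (simpleRefl b θ i) q = q) : divDiff b θ i (p * q) = divDiff b θ i p * q :=
  divDiff_eq b θ (by rw [← mul_assoc, simpleXi_mul_divDiff, map_mul, hq]; ring)

/-- If `s_i μ = μ`, the generators of `[μ]` are `s_i`-invariant, hence scalars for the divided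
difference; otherwise `ξ_{α_i^∨}` is invertible modulo `[μ]`. -/
lemma divDiff_mem_invIdeal [Finite ι] [P.IsRootSystem] (i : Option b.support) {μ : V} {p : SPrime P}
    (hp : p ∈ invIdeal P μ) (hp' : p ∈ invIdeal P (simpleRefl b θ i • μ)) :
    divDiff b θ i p ∈ invIdeal P μ := by
  by_cases hμ : simpleRefl b θ i • μ = μ
  · clear hp'
    induction hp using Submodule.span_induction with
    | mem x hx =>
      have : x = 1 * x := (one_mul x).symm
      rw [this, divDiff_mul_of_act_eq b θ i 1 (hx.2 _ hμ)]
      exact Ideal.mul_mem_left _ _ (Ideal.subset_span hx)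
    | zero =>
      have : divDiff b θ i (0 : SPrime P) = 0 := divDiff_eq b θ (by simp)
      rw [this]; exact zero_mem _
    | add x y _ _ hx hy => rw [divDiff_add]; exact add_mem hx hy
    | smul a x hx ih =>
      -- `ϑ(a x) = ϑ(a) x + ˢa ϑ(x)`
      have : divDiff b θ i (a • x)
          = divDiff b θ i a * x + act P (simpleRefl b θ i) a * divDiff b θ i x := by
        refine divDiff_eq b θ ?_
        rw [mul_add, ← mul_assoc, simpleXi_mul_divDiff, mul_left_comm, simpleXi_mul_divDiff,
          smul_eq_mul, map_mul]
        ring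
      rw [this]
      exact add_mem (Ideal.mul_mem_left _ _ hx) (Ideal.mul_mem_left _ _ ih)
  · have h1 : simpleXi b θ i * divDiff b θ i p ∈ invIdeal P μ := by
      rw [simpleXi_mul_divDiff]
      refine sub_mem hp ?_
      have := act_mem_invIdeal (simpleRefl b θ i) hp'
      rwa [smul_smul, simpleRefl_mul_self, one_smul] at this
    rw [mul_comm] at h1
    refine ((Ideal.isPrimary_iff.mp (isPrimary_invIdeal μ)).2 h1).resolve_right fun h2 => hμ ?_
    rw [radical_invIdeal, mem_maxIdeal] at h2
    rw [simpleRefl_smul, h2, zero_smul, sub_zero]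

end DividedDifferences

/-! ### Modules over the degenerate double affine Hecke algebra -/

section Hecke

variable (b : P.Base) (θ : ι) (h : ι → k)

/-- The canonical map `Ŵ → H'`. -/
def ofG : AffineWeyl P →* HPrime b θ h where
  toFun g := mkH b θ h (FreeAlgebra.ι k (Sum.inl g))
  map_one' := by rw [mkH_rel b θ h Rel.group_one, map_one]
  map_mul' g g' := by rw [mkH_rel b θ h (Rel.group_mul g g'), map_mul]

lemma ofG_mul_ofS (i : Option b.support) (p : SPrime P) :
    ofG b θ h (simpleRefl b θ i) * ofS b θ h p
      = ofS b θ h (act P (simpleRefl b θ i) p) * ofG b θ h (simpleRefl b θ i)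
        + ofS b θ h (algebraMap k _ (simpleParam b θ h i) * divDiff b θ i p) := by
  have h1 := mkH_rel b θ h (Rel.cross i p)
  rw [map_sub, map_mul, map_mul, map_smul, sub_eq_iff_eq_add'] at h1
  rw [← Algebra.smul_def, map_smul]
  exact h1

/-- `S'` acts on `H'` by left multiplication. -/
instance : Module (SPrime P) (HPrime b θ h) :=
  Module.compHom _ (ofS b θ h : SPrime P →+* HPrime b θ h)

variable {b θ h}

/-- The algebra `H'` is generated by `S'` and the simple reflections. -/
lemma hPrime_induction [CharZero k] [Finite ι] [P.IsCrystallographic] [P.IsReduced]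
    [P.IsRootSystem] [P.IsIrreducible] (hθ : IsMaxCoroot b θ) {motive : HPrime b θ h → Prop}
    (ofS : ∀ p, motive (ofS b θ h p)) (refl : ∀ i, motive (ofG b θ h (simpleRefl b θ i)))
    (mul : ∀ x y, motive x → motive y → motive (x * y))
    (add : ∀ x y, motive x → motive y → motive (x + y)) (a : HPrime b θ h) : motive a := by
  have hG : ∀ g : AffineWeyl P, motive (ofG b θ h g) := by
    intro g
    have hg : g ∈ Subgroup.closure (Set.range (simpleRefl b θ)) := by
      rw [closure_simpleRefl hθ]; trivial
    induction hg using Subgroup.closure_induction'' with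
    | mem x hx => obtain ⟨i, rfl⟩ := hx; exact refl i
    | inv_mem x hx => obtain ⟨i, rfl⟩ := hx; rw [simpleRefl_inv]; exact refl i
    | one => rw [map_one, ← map_one (DDAHA.ofS b θ h)]; exact ofS 1
    | mul x y _ _ hx hy => rw [map_mul]; exact mul _ _ hx hy
  obtain ⟨a, rfl⟩ := RingQuot.mkAlgHom_surjective k (Rel b θ h) a
  change motive (mkH b θ h a)
  induction a using FreeAlgebra.induction with
  | grade0 r =>
    rw [AlgHom.commutes, ← AlgHom.commutes (DDAHA.ofS b θ h)]
    exact ofS _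
  | grade1 x =>
    cases x with
    | inl g => exact hG g
    | inr p => exact ofS p
  | mul x y hx hy => rw [map_mul]; exact mul _ _ hx hy
  | add x y hx hy => rw [map_add]; exact add _ _ hx hy

variable {M : Type*} [AddCommGroup M] [Module (HPrime b θ h) M] [Module (SPrime P) M]
  [IsScalarTower (SPrime P) (HPrime b θ h) M]

variable (b θ h) in
lemma ofS_smul (p : SPrime P) (m : M) : ofS b θ h p • m = p • m := by
  have h1 : p • (1 : HPrime b θ h) = ofS b θ h p := mul_one _
  rw [← h1, smul_assoc, one_smul]

variable (b θ h) in
lemma simpleRefl_smul_smul (i : Option b.support) (p : SPrime P) (m : M) :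
    ofG b θ h (simpleRefl b θ i) • p • m
      = act P (simpleRefl b θ i) p • ofG b θ h (simpleRefl b θ i) • m
        + (algebraMap k _ (simpleParam b θ h i) * divDiff b θ i p) • m := by
  rw [← ofS_smul b θ h p, ← ofS_smul b θ h (act P _ p), ← ofS_smul b θ h (_ * _), ← mul_smul,
    ofG_mul_ofS, add_smul, mul_smul]

section Intertwiner

variable [CharZero k]

variable (b θ h) in
/-- The intertwining operator `φ_i = s_i ξ_{α_i^∨} - h_i`, for which `φ_i p = ^{s_i}p φ_i`. -/
def intertwiner (i : Option b.support) (m : M) : M :=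
  ofG b θ h (simpleRefl b θ i) • simpleXi b θ i • m
    - algebraMap k (SPrime P) (simpleParam b θ h i) • m

lemma intertwiner_eq (i : Option b.support) (m : M) :
    intertwiner b θ h i m = -(simpleXi b θ i • ofG b θ h (simpleRefl b θ i) • m)
      + algebraMap k (SPrime P) (simpleParam b θ h i) • m := by
  have h2 : divDiff b θ i (simpleXi b θ i) = 2 := by
    have := divDiff_simpleXi_mul b θ i 1
    rwa [mul_one, map_one, one_add_one_eq_two] at this
  rw [intertwiner, simpleRefl_smul_smul, act_simpleRefl_simpleXi, h2]
  generalize ofG b θ h (simpleRefl b θ i) • m = x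
  module

lemma intertwiner_smul (i : Option b.support) (p : SPrime P) (m : M) :
    intertwiner b θ h i (p • m) = act P (simpleRefl b θ i) p • intertwiner b θ h i m := by
  rw [intertwiner_eq i m, intertwiner, smul_smul, simpleRefl_smul_smul, map_mul,
    act_simpleRefl_simpleXi, divDiff_simpleXi_mul]
  generalize ofG b θ h (simpleRefl b θ i) • m = x
  module

lemma intertwiner_intertwiner (i : Option b.support) (m : M) :
    intertwiner b θ h i (intertwiner b θ h i m)
      = (algebraMap k (SPrime P) (simpleParam b θ h i ^ 2) - simpleXi b θ i ^ 2) • m := by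
  have h1 : intertwiner b θ h i (intertwiner b θ h i m)
      = - (simpleXi b θ i • ofG b θ h (simpleRefl b θ i) • intertwiner b θ h i m)
        + algebraMap k (SPrime P) (simpleParam b θ h i) • intertwiner b θ h i m :=
    intertwiner_eq i _
  have hs : ofG b θ h (simpleRefl b θ i) • ofG b θ h (simpleRefl b θ i) • simpleXi b θ i • m
      = simpleXi b θ i • m := by
    rw [smul_smul, ← map_mul, simpleRefl_mul_self, map_one, one_smul]
  have hc : ofG b θ h (simpleRefl b θ i) • algebraMap k (SPrime P) (simpleParam b θ h i) • m
      = algebraMap k (SPrime P) (simpleParam b θ h i) • ofG b θ h (simpleRefl b θ i) • m := by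
    have : divDiff b θ i (algebraMap k (SPrime P) (simpleParam b θ h i)) = 0 :=
      divDiff_eq b θ (by simp)
    rw [simpleRefl_smul_smul, this, AlgHom.commutes, mul_zero, zero_smul, add_zero]
  rw [h1, intertwiner_eq i m, ← intertwiner_eq i m]
  nth_rewrite 1 [intertwiner]
  rw [smul_sub, hs, hc, intertwiner_eq i m, map_pow]
  generalize ofG b θ h (simpleRefl b θ i) • m = x
  module

end Intertwiner

/-- If `[E]` kills `m` for a finite set `E`, then `[E ∪ s_i E]` kills `s_i m`. -/
lemma iInf_invIdeal_le_torsionOf_simpleRefl_smul [CharZero k] [Finite ι] [P.IsRootSystem]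
    [DecidableEq V] (i : Option b.support) {E : Finset V} {m : M}
    (hE : ⨅ μ ∈ E, invIdeal P μ ≤ Ideal.torsionOf (SPrime P) M m) :
    ⨅ μ ∈ E ∪ E.image (simpleRefl b θ i • ·), invIdeal P μ
      ≤ Ideal.torsionOf (SPrime P) M (ofG b θ h (simpleRefl b θ i) • m) := by
  intro p hp
  simp only [Submodule.mem_iInf] at hp
  have hmem : ∀ {q : SPrime P}, (∀ μ ∈ E, q ∈ invIdeal P μ) → q ∈ ⨅ μ ∈ E, invIdeal P μ :=
    fun hq => by simpa only [Submodule.mem_iInf] using hq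
  have h1 : ∀ μ ∈ E, act P (simpleRefl b θ i) p ∈ invIdeal P μ := fun μ hμ => by
    have := act_mem_invIdeal (simpleRefl b θ i) (hp (simpleRefl b θ i • μ)
      (Finset.mem_union_right _ (Finset.mem_image_of_mem _ hμ)))
    rwa [smul_smul, simpleRefl_mul_self, one_smul] at this
  have h2 : ∀ μ ∈ E, divDiff b θ i (act P (simpleRefl b θ i) p) ∈ invIdeal P μ := fun μ hμ =>
    divDiff_mem_invIdeal b θ i (h1 μ hμ)
      (act_mem_invIdeal _ (hp μ (Finset.mem_union_left _ hμ)))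
  have h3 : act P (simpleRefl b θ i) p • m = 0 := hE (hmem h1)
  have h4 : (algebraMap k (SPrime P) (simpleParam b θ h i) *
      divDiff b θ i (act P (simpleRefl b θ i) p)) • m = 0 :=
    hE (Ideal.mul_mem_left _ _ (hmem h2))
  have h5 := simpleRefl_smul_smul b θ h i (act P (simpleRefl b θ i) p) m
  rw [h3, h4, smul_zero, add_zero, ← act_mul_apply, simpleRefl_mul_self, act_one_apply] at h5
  exact h5.symm

end Hecke

/-! ### The filtration by word length -/

section WordFiltration

variable (b : P.Base) (θ : ι)

/-- The elements of `Ŵ` which are products of less than `n` simple reflections. -/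
def wordBall : ℕ → Set (AffineWeyl P)
  | 0 => ∅
  | n + 1 => insert 1 (⋃ i, (simpleRefl b θ i * ·) '' wordBall n)

lemma finite_wordBall (n : ℕ) : (wordBall b θ n).Finite := by
  induction n with
  | zero => exact Set.finite_empty
  | succ n ih => exact (Set.finite_iUnion fun i => ih.image _).insert 1

lemma one_mem_wordBall (n : ℕ) : 1 ∈ wordBall b θ (n + 1) := Set.mem_insert _ _

lemma simpleRefl_mul_mem_wordBall {n : ℕ} {g : AffineWeyl P} (hg : g ∈ wordBall b θ n)
    (i : Option b.support) : simpleRefl b θ i * g ∈ wordBall b θ (n + 1) :=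
  Set.mem_insert_of_mem _ (Set.mem_iUnion.mpr ⟨i, g, hg, rfl⟩)

lemma wordBall_mono : Monotone (wordBall b θ) := by
  refine monotone_nat_of_le_succ fun n => ?_
  induction n with
  | zero => exact Set.empty_subset _
  | succ n ih =>
    rintro g (rfl | hg)
    · exact one_mem_wordBall b θ _
    · obtain ⟨i, g', hg', rfl⟩ := Set.mem_iUnion.mp hg
      exact simpleRefl_mul_mem_wordBall b θ (ih hg') i

variable {b θ}

lemma exists_mem_wordBall [CharZero k] [Finite ι] [P.IsCrystallographic] [P.IsReduced]
    [P.IsRootSystem] [P.IsIrreducible] (hθ : IsMaxCoroot b θ) (g : AffineWeyl P) :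
    ∃ n, g ∈ wordBall b θ n := by
  have hg : g ∈ Subgroup.closure (Set.range (simpleRefl b θ)) := by
    rw [closure_simpleRefl hθ]; trivial
  induction hg using Subgroup.closure_induction_left with
  | one => exact ⟨1, one_mem_wordBall b θ 0⟩
  | mul_left x hx y _ ih =>
    obtain ⟨i, rfl⟩ := hx
    obtain ⟨n, hn⟩ := ih
    exact ⟨n + 1, simpleRefl_mul_mem_wordBall b θ hn i⟩
  | inv_mul_cancel x hx y _ ih =>
    obtain ⟨i, rfl⟩ := hx
    obtain ⟨n, hn⟩ := ih
    rw [simpleRefl_inv]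
    exact ⟨n + 1, simpleRefl_mul_mem_wordBall b θ hn i⟩

lemma exists_subset_wordBall [CharZero k] [Finite ι] [P.IsCrystallographic] [P.IsReduced]
    [P.IsRootSystem] [P.IsIrreducible] (hθ : IsMaxCoroot b θ) {A : Set (AffineWeyl P)}
    (hA : A.Finite) : ∃ n, A ⊆ wordBall b θ n := by
  induction A, hA using Set.Finite.induction_on with
  | empty => exact ⟨0, Set.empty_subset _⟩
  | insert _ _ ih =>
    rename_i g A _ _
    obtain ⟨n, hn⟩ := ih
    obtain ⟨m, hm⟩ := exists_mem_wordBall hθ g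
    refine ⟨max m n, Set.insert_subset (wordBall_mono b θ (le_max_left _ _) hm)
      (hn.trans (wordBall_mono b θ (le_max_right _ _)))⟩

end WordFiltration

section Filtration

variable {b : P.Base} {θ : ι} {h : ι → k}
variable {M : Type*} [AddCommGroup M] [Module (HPrime b θ h) M] [Module (SPrime P) M]

variable (b θ h) in
/-- The filtration of a module with a given set of generators by the length of words in the simple
reflections. -/
def wordFil (gens : Set M) (n : ℕ) : Submodule (SPrime P) M :=
  Submodule.span (SPrime P) (Set.image2 (fun g m => ofG b θ h g • m) (wordBall b θ n) gens)

variable {gens : Set M}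

lemma smul_mem_wordFil {n : ℕ} {g : AffineWeyl P} (hg : g ∈ wordBall b θ n) {m : M}
    (hm : m ∈ gens) : ofG b θ h g • m ∈ wordFil b θ h gens n :=
  Submodule.subset_span ⟨g, hg, m, hm, rfl⟩

lemma wordFil_mono : Monotone (wordFil b θ h gens) := fun _ _ hmn =>
  Submodule.span_mono (Set.image2_subset (wordBall_mono b θ hmn) subset_rfl)

lemma wordFil_zero : wordFil b θ h gens 0 = ⊥ := by
  simp [wordFil, wordBall]

variable [IsScalarTower (SPrime P) (HPrime b θ h) M]

lemma simpleRefl_smul_mem_wordFil (i : Option b.support) {n : ℕ} {x : M}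
    (hx : x ∈ wordFil b θ h gens n) :
    ofG b θ h (simpleRefl b θ i) • x ∈ wordFil b θ h gens (n + 1) := by
  induction hx using Submodule.span_induction with
  | mem x hx =>
    obtain ⟨g, hg, m, hm, rfl⟩ := hx
    change ofG b θ h (simpleRefl b θ i) • ofG b θ h g • m ∈ _
    rw [smul_smul, ← map_mul]
    exact smul_mem_wordFil (simpleRefl_mul_mem_wordBall b θ hg i) hm
  | zero => rw [smul_zero]; exact zero_mem _
  | add x y _ _ hx hy => rw [smul_add]; exact add_mem hx hy
  | smul p x hx ih =>
    rw [simpleRefl_smul_smul]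
    exact add_mem (Submodule.smul_mem _ _ ih)
      (Submodule.smul_mem _ _ (wordFil_mono (Nat.le_succ n) hx))

lemma exists_mem_wordFil [CharZero k] [Finite ι] [P.IsCrystallographic] [P.IsReduced]
    [P.IsRootSystem] [P.IsIrreducible] (hθ : IsMaxCoroot b θ)
    (hgens : Submodule.span (HPrime b θ h) gens = ⊤) (x : M) : ∃ n, x ∈ wordFil b θ h gens n := by
  have hstable : ∀ (a : HPrime b θ h) (x : M), (∃ n, x ∈ wordFil b θ h gens n) →
      ∃ n, a • x ∈ wordFil b θ h gens n := by
    intro a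
    induction a using hPrime_induction hθ with
    | ofS p =>
      rintro x ⟨n, hn⟩
      exact ⟨n, by rw [ofS_smul]; exact Submodule.smul_mem _ _ hn⟩
    | refl i =>
      rintro x ⟨n, hn⟩
      exact ⟨n + 1, simpleRefl_smul_mem_wordFil i hn⟩
    | mul a a' ha ha' =>
      intro x hx
      rw [mul_smul]
      exact ha _ (ha' _ hx)
    | add a a' ha ha' =>
      intro x hx
      obtain ⟨n, hn⟩ := ha x hx
      obtain ⟨m, hm⟩ := ha' x hx
      rw [add_smul]
      exact ⟨max n m, add_mem (wordFil_mono (le_max_left _ _) hn)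
        (wordFil_mono (le_max_right _ _) hm)⟩
  have hx : x ∈ Submodule.span (HPrime b θ h) gens := hgens ▸ Submodule.mem_top
  induction hx using Submodule.span_induction with
  | mem x hx =>
    refine ⟨1, ?_⟩
    have := smul_mem_wordFil (h := h) (one_mem_wordBall b θ 0) hx
    rwa [map_one, one_smul] at this
  | zero => exact ⟨0, zero_mem _⟩
  | add x y _ _ hx hy =>
    obtain ⟨n, hn⟩ := hx
    obtain ⟨m, hm⟩ := hy
    exact ⟨max n m, add_mem (wordFil_mono (le_max_left _ _) hn)
      (wordFil_mono (le_max_right _ _) hm)⟩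
  | smul a x _ hx => exact hstable a x hx

/-- Modulo shorter words, `p g = g ᵍ⁻¹p`. -/
lemma smul_sub_mem_wordFil {m : M} (hm : m ∈ gens) {n : ℕ} {g : AffineWeyl P}
    (hg : g ∈ wordBall b θ (n + 1)) (p : SPrime P) :
    p • ofG b θ h g • m - ofG b θ h g • act P g⁻¹ p • m ∈ wordFil b θ h gens n := by
  induction n generalizing g p with
  | zero =>
    rcases hg with rfl | hg
    · simp [act_one_apply]
    · simp [wordBall] at hg
  | succ n ih =>
    rcases hg with rfl | hg
    · simp [act_one_apply]
    · obtain ⟨i, g', hg', rfl⟩ := Set.mem_iUnion.mp hg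
      simp only
      set q := act P (simpleRefl b θ i) p with hq
      have hp : p = act P (simpleRefl b θ i) q := by
        rw [hq, ← act_mul_apply, simpleRefl_mul_self, act_one_apply]
      have h1 : act P (simpleRefl b θ i * g')⁻¹ p = act P g'⁻¹ q := by
        rw [mul_inv_rev, act_mul_apply, simpleRefl_inv]
      have h2 := simpleRefl_smul_smul b θ h i q (ofG b θ h g' • m)
      rw [← hp] at h2
      have h3 := simpleRefl_smul_mem_wordFil (h := h) i (ih hg' q)
      rw [smul_sub, h2] at h3
      have h4 := Submodule.smul_mem _ (algebraMap k _ (simpleParam b θ h i) * divDiff b θ i q)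
        (smul_mem_wordFil (h := h) hg' hm)
      rw [h1, map_mul, mul_smul, mul_smul]
      convert sub_mem h3 h4 using 1
      abel

/-- On the `n`-th graded piece of the word filtration, spanned by the `g m`, acts the product of the
translates by these `g` of an ideal killing the generators. -/
lemma prod_twist_smul_mem_wordFil {J : Ideal (SPrime P)}
    (hJ : ∀ m ∈ gens, J ≤ Ideal.torsionOf (SPrime P) M m) (n : ℕ) {x : M}
    (hx : x ∈ wordFil b θ h gens (n + 1)) {A : Finset (AffineWeyl P)}
    (hA : wordBall b θ (n + 1) ⊆ wordBall b θ n ∪ A) {q : SPrime P} (hq : q ∈ ∏ g ∈ A, twist g J) :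
    q • x ∈ wordFil b θ h gens n := by
  induction hx using Submodule.span_induction with
  | mem x hx =>
    obtain ⟨g, hg, m, hm, rfl⟩ := hx
    rcases hA hg with hg' | hg'
    · exact Submodule.smul_mem _ _ (smul_mem_wordFil hg' hm)
    · have h1 : q ∈ twist g J := by
        have h2 := Ideal.prod_le_inf hq
        rw [Submodule.mem_finsetInf] at h2
        exact h2 g hg'
      have h2 : act P g⁻¹ q • m = 0 := hJ m hm h1
      have h3 := smul_sub_mem_wordFil (h := h) hm hg q
      rwa [h2, smul_zero, sub_zero] at h3
  | zero => rw [smul_zero]; exact zero_mem _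
  | add x y _ _ hx hy => rw [smul_add]; exact add_mem hx hy
  | smul p x hx ih => rw [smul_comm]; exact Submodule.smul_mem _ _ ih

lemma exists_smul_ne_zero_of_prod {A N κ : Type*} [CommRing A] [AddCommGroup N] [Module A N]
    (s : Finset κ) (I : κ → Ideal A) {x : N} (hx : x ≠ 0)
    (hI : ∏ i ∈ s, I i ≤ Ideal.torsionOf A N x) :
    ∃ i ∈ s, ∃ a : A, a • x ≠ 0 ∧ I i ≤ Ideal.torsionOf A N (a • x) := by
  classical
  induction s using Finset.induction_on generalizing x with
  | empty =>
    rw [Finset.prod_empty, Ideal.one_eq_top] at hI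
    have : (1 : A) • x = 0 := hI (Submodule.mem_top)
    rw [one_smul] at this
    exact absurd this hx
  | insert i s his ih =>
    rw [Finset.prod_insert his] at hI
    by_cases hs : ∏ i ∈ s, I i ≤ Ideal.torsionOf A N x
    · obtain ⟨j, hj, a, ha, ha'⟩ := ih hx hs
      exact ⟨j, Finset.mem_insert_of_mem hj, a, ha, ha'⟩
    · obtain ⟨a, ha, ha'⟩ := SetLike.not_le_iff_exists.mp hs
      refine ⟨i, Finset.mem_insert_self _ _, a, ha', fun c hc => ?_⟩
      have : (c * a) • x = 0 := hI (Ideal.mul_mem_mul hc ha)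
      rwa [mul_smul] at this

/-- Every nonzero submodule of a module generated by vectors killed by `J` contains a nonzero vector
killed by some translate of `J`: take a nonzero element in the smallest possible step of the word
filtration. -/
lemma exists_twist_le_torsionOf [CharZero k] [Finite ι] [P.IsCrystallographic] [P.IsReduced]
    [P.IsRootSystem] [P.IsIrreducible] (hθ : IsMaxCoroot b θ) {J : Ideal (SPrime P)}
    (hJ : ∀ m ∈ gens, J ≤ Ideal.torsionOf (SPrime P) M m)
    (hgens : Submodule.span (HPrime b θ h) gens = ⊤) {N : Submodule (HPrime b θ h) M}
    (hN : N ≠ ⊥) :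
    ∃ g, ∃ x ∈ N, x ≠ 0 ∧ twist g J ≤ Ideal.torsionOf (SPrime P) M x := by
  classical
  have hex : ∃ n, ∃ x ∈ N, x ≠ 0 ∧ x ∈ wordFil b θ h gens n := by
    obtain ⟨x, hx, hx0⟩ := N.ne_bot_iff.mp hN
    obtain ⟨n, hn⟩ := exists_mem_wordFil hθ hgens x
    exact ⟨n, x, hx, hx0, hn⟩
  obtain ⟨x, hx, hx0, hxn⟩ := Nat.find_spec hex
  rcases hfind : Nat.find hex with _ | n
  · rw [hfind, wordFil_zero] at hxn
    exact absurd hxn hx0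
  · rw [hfind] at hxn
    have hmin := Nat.find_min hex (m := n) (by omega)
    push Not at hmin
    have hN' : ∀ (p : SPrime P) {y : M}, y ∈ N → p • y ∈ N := fun p y hy => by
      rw [← ofS_smul b θ h]; exact N.smul_mem _ hy
    obtain ⟨g, _, a, ha, hg⟩ := exists_smul_ne_zero_of_prod
      (finite_wordBall b θ (n + 1)).toFinset (fun g => twist g J) hx0 (fun q hq => by
        by_contra hne
        exact hmin _ (hN' q hx) hne
          (prod_twist_smul_mem_wordFil hJ n hxn (fun g hg => Or.inr (by simpa using hg)) hq))
    exact ⟨g, a • x, hN' a hx, ha, hg⟩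

end Filtration

/-! ### Descent by intertwiners -/

section Descent

variable [CharZero k] [Finite ι] [P.IsCrystallographic] [P.IsRootSystem] {b : P.Base} {θ : ι}

lemma exists_lower_bound_of_finite {Z : Set ℤ} (hZ : Z.Finite) (c : ι → ℤ) (s : ℤ) :
    ∃ C : ℤ, 0 ≤ C ∧ ∀ n ∈ Z, ∀ j, -C ≤ c j + s * n := by
  have hfin : ((fun x : ι × ℤ => -(c x.1 + s * x.2)) '' (Set.univ ×ˢ Z)).Finite :=
    (Set.finite_univ.prod hZ).image _
  obtain ⟨C, hC⟩ := hfin.bddAbove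
  refine ⟨max C 0, le_max_right _ _, fun n hn j => ?_⟩
  have := hC ⟨(j, n), ⟨Set.mem_univ _, hn⟩, rfl⟩
  simp only at this
  have := le_max_left C 0
  omega

/-- If a module contains a nonzero vector killed by some translate of `J`, then it contains one killed
by `ᵍJ` for some `g` in a finite set `Ω` which does not depend on the module. Choose `g` such that
`g x₀` is as close as possible to `x₀`: when `ξ_{α_i^∨}` is negative at `g x₀`, the intertwiner of `s_i`
must kill the vector, and this bounds `ξ_{α_i^∨}` from below at `g x₀`. -/
lemma exists_finite_twist (hθ : IsMaxCoroot b θ) (h : ι → k) (J : Ideal (SPrime P))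
    [Module.Finite k (SPrime P ⧸ J)] :
    ∃ Ω : Set (AffineWeyl P), Ω.Finite ∧ ∀ (M : Type u) [AddCommGroup M] [Module (HPrime b θ h) M]
      [Module (SPrime P) M] [IsScalarTower (SPrime P) (HPrime b θ h) M],
      (∃ g, ∃ x : M, x ≠ 0 ∧ twist g J ≤ Ideal.torsionOf (SPrime P) M x) →
      ∃ g ∈ Ω, ∃ x : M, x ≠ 0 ∧ twist g J ≤ Ideal.torsionOf (SPrime P) M x := by
  -- the `n` such that `(ξ_{α^∨} + n)² - h_i²` is not invertible modulo `J`, for some `α` and `i`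
  let Z : Set ℤ := ⋃ i : Option b.support, ⋃ j : ι,
    {n : ℤ | Ideal.span {(xi P (P.coroot j) + algebraMap k _ (n : k)) ^ 2
      - algebraMap k _ (simpleParam b θ h i ^ 2)} ⊔ J ≠ ⊤}
  have hZ : Z.Finite := Set.finite_iUnion fun i => Set.finite_iUnion fun j =>
    finite_setOf_span_sup_ne_top J j _
  obtain ⟨C, hC0, hC⟩ := exists_lower_bound_of_finite hZ (coheight b) (alcoveScale b θ)
  refine ⟨_, finite_setOf_le_simpleXi hθ C, ?_⟩
  intro M _ _ _ _ hM
  let S : Set (AffineWeyl P) := {g | ∃ x : M, x ≠ 0 ∧ twist g J ≤ Ideal.torsionOf (SPrime P) M x}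
  obtain ⟨g, hgS, hmin⟩ := (measure fun g => (alcoveDist b θ hθ g).toNat).wf.has_min S hM
  refine ⟨g, fun i => ?_, hgS⟩
  obtain ⟨x, hx0, hx⟩ := hgS
  obtain ⟨t, j, n, ht, hact, htn⟩ := exists_scale_mul_simpleXi hθ g i
  refine ⟨t, ht, ?_⟩
  rcases le_or_gt 0 t with ht0 | ht0
  · omega
  rw [htn]
  refine hC n ?_ j
  have hlt : (alcoveDist b θ hθ (simpleRefl b θ i * g)).toNat < (alcoveDist b θ hθ g).toNat := by
    have := alcoveDist_simpleRefl_mul_lt hθ g i ht ht0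
    have := alcoveDist_nonneg hθ (simpleRefl b θ i * g)
    omega
  -- otherwise `φ_i x` is killed by the translate of `J` by `s_i g`, contrary to the choice of `g`
  have hφ : intertwiner b θ h i x = 0 := by
    by_contra hne
    refine hmin _ ⟨_, hne, fun p hp => ?_⟩ hlt
    have h1 := act_mem_twist_mul (g := simpleRefl b θ i) hp
    rw [← mul_assoc, simpleRefl_mul_self, one_mul] at h1
    have h2 : act P (simpleRefl b θ i) p • x = 0 := hx h1
    have h3 := intertwiner_smul (b := b) (θ := θ) (h := h) i (act P (simpleRefl b θ i) p) x
    rw [h2, ← act_mul_apply, simpleRefl_mul_self, act_one_apply] at h3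
    change p • intertwiner b θ h i x = 0
    rw [← h3, intertwiner, smul_zero, smul_zero, smul_zero, sub_zero]
  have hsq : (algebraMap k (SPrime P) (simpleParam b θ h i ^ 2) - simpleXi b θ i ^ 2) • x = 0 := by
    rw [← intertwiner_intertwiner (b := b) (θ := θ) (h := h), hφ, intertwiner, smul_zero,
      smul_zero, smul_zero, sub_zero]
  refine Set.mem_iUnion.mpr ⟨i, Set.mem_iUnion.mpr ⟨j, fun htop => hx0 ?_⟩⟩
  -- both `ξ_{α_i^∨}² - h_i²` and `ᵍJ` kill `x`, but they are comaximal if `n ∉ Z`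
  obtain ⟨a, ha, v, hv, hav⟩ := Submodule.mem_sup.mp ((Ideal.eq_top_iff_one _).mp htop)
  obtain ⟨a, rfl⟩ := Ideal.mem_span_singleton'.mp ha
  have h1 := congrArg (act P g) hav
  rw [← hact, map_add, map_mul, map_sub, map_pow, act_act_inv, AlgHom.commutes, map_one] at h1
  have h2 : act P g v • x = 0 := hx (act_mem_twist hv)
  rw [← one_smul (SPrime P) x, ← h1, add_smul, h2, add_zero, mul_smul, ← neg_sub, neg_smul, hsq,
    neg_zero, smul_zero]

end Descent

/-! ### Finite length -/

section FiniteLength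

/-- In a finite-dimensional quotient `A/K`, the powers of an ideal `I` become stationary, and some
element congruent to one modulo `I` kills the stable power. -/
lemma exists_one_sub_mem_mul_mem {A : Type*} [CommRing A] [Algebra k A] (I K : Ideal A)
    [Module.Finite k (A ⧸ K)] : ∃ (n : ℕ) (r : A), 1 - r ∈ I ∧ ∀ p ∈ I ^ n, r * p ∈ K := by
  have : IsArtinian (A ⧸ K) (A ⧸ K) := isArtinian_of_tower k inferInstance
  have : IsNoetherian (A ⧸ K) (A ⧸ K) := isNoetherian_of_tower k inferInstance
  let I' : Ideal (A ⧸ K) := I.map (Ideal.Quotient.mk K)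
  obtain ⟨n, hn⟩ := IsArtinian.monotone_stabilizes
    (⟨fun n => OrderDual.toDual (I' ^ n), fun m n hmn => Ideal.pow_le_pow_right hmn⟩ :
      ℕ →o (Ideal (A ⧸ K))ᵒᵈ)
  have hn' : I' ^ n = I' ^ (n + 1) := hn (n + 1) (Nat.le_succ n)
  obtain ⟨r', hr', hr''⟩ := Submodule.exists_sub_one_mem_and_smul_eq_zero_of_fg_of_le_smul I'
    (I' ^ n) (IsNoetherian.noetherian _) (by
      rw [smul_eq_mul, ← pow_succ']; exact hn'.le)
  obtain ⟨a, ha, har⟩ := (Ideal.mem_map_iff_of_surjective _ Ideal.Quotient.mk_surjective).mp hr'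
  refine ⟨n, 1 + a, by simpa using ha, fun p hp => ?_⟩
  rw [← Ideal.Quotient.eq_zero_iff_mem, map_mul, map_add, map_one, har]
  have h1 : Ideal.Quotient.mk K p ∈ I' ^ n := by
    rw [← Ideal.map_pow]; exact Ideal.mem_map_of_mem _ hp
  have h2 := hr'' _ h1
  rw [smul_eq_mul] at h2
  rw [add_sub_cancel, h2]

variable {A : Type*} [CommRing A] [Algebra k A] {M : Type*} [AddCommGroup M] [Module A M]

lemma isArtinian_isNoetherian_span (hM : ∀ m : M, Module.Finite k (A ⧸ Ideal.torsionOf A M m))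
    (s : Set M) [Finite s] :
    IsArtinian A (Submodule.span A s) ∧ IsNoetherian A (Submodule.span A s) := by
  have h1 : ∀ m : M, IsArtinian A (Submodule.span A {m}) ∧ IsNoetherian A (Submodule.span A {m}) := by
    intro m
    have := hM m
    have h2 : IsArtinian A (A ⧸ Ideal.torsionOf A M m) := isArtinian_of_tower k inferInstance
    have h3 : IsNoetherian A (A ⧸ Ideal.torsionOf A M m) := isNoetherian_of_tower k inferInstance
    exact ⟨(Ideal.quotTorsionOfEquivSpanSingleton A M m).isArtinian_iff.mp h2,
      isNoetherian_of_linearEquiv (Ideal.quotTorsionOfEquivSpanSingleton A M m)⟩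
  have := fun m => (h1 m).1
  have := fun m => (h1 m).2
  have h2 : Submodule.span A s = ⨆ m : s, Submodule.span A {(m : M)} := by
    rw [← Submodule.span_iUnion]
    congr 1
    ext x; simp
  rw [h2]
  exact ⟨inferInstance, inferInstance⟩

/-- The submodule of the elements killed by a power of `I`. -/
def powerTorsion (I : Ideal A) (M : Type*) [AddCommGroup M] [Module A M] : Submodule A M where
  carrier := {x | ∃ n : ℕ, I ^ n ≤ Ideal.torsionOf A M x}
  zero_mem' := ⟨0, by simp⟩
  add_mem' := by
    rintro x y ⟨m, hm⟩ ⟨n, hn⟩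
    refine ⟨max m n, fun p hp => ?_⟩
    have h1 : p • x = 0 := hm (Ideal.pow_le_pow_right (le_max_left _ _) hp)
    have h2 : p • y = 0 := hn (Ideal.pow_le_pow_right (le_max_right _ _) hp)
    change p • (x + y) = 0
    rw [smul_add, h1, h2, add_zero]
  smul_mem' := by
    rintro a x ⟨n, hn⟩
    refine ⟨n, fun p hp => ?_⟩
    have h1 : p • x = 0 := hn hp
    change p • a • x = 0
    rw [smul_comm, h1, smul_zero]

end FiniteLength

section LocallyFinite

variable [CharZero k] [Finite ι] [P.IsCrystallographic] [P.IsReduced] [P.IsRootSystem]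
  [P.IsIrreducible] {b : P.Base} {θ : ι} {h : ι → k}
variable {M : Type u} [AddCommGroup M] [Module (HPrime b θ h) M] [Module (SPrime P) M]
  [IsScalarTower (SPrime P) (HPrime b θ h) M]

/-- Only finitely many translates `ᵍJ` are not comaximal to `I`, so the power torsion of `I` is
contained in a step of the word filtration. -/
lemma exists_powerTorsion_le_wordFil (hθ : IsMaxCoroot b θ) {gens : Set M}
    (hgens : Submodule.span (HPrime b θ h) gens = ⊤) {I J : Ideal (SPrime P)}
    (hJ : ∀ m ∈ gens, J ≤ Ideal.torsionOf (SPrime P) M m)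
    (hIJ : {g : AffineWeyl P | twist g J ⊔ I ≠ ⊤}.Finite) :
    ∃ n, powerTorsion I M ≤ wordFil b θ h gens n := by
  classical
  obtain ⟨n₀, hn₀⟩ := exists_subset_wordBall hθ hIJ
  refine ⟨n₀, fun x hx => ?_⟩
  obtain ⟨l, hl⟩ := hx
  obtain ⟨n, hn⟩ := exists_mem_wordFil hθ hgens x
  rcases le_total n n₀ with hle | hle
  · exact wordFil_mono hle hn
  induction n, hle using Nat.le_induction with
  | base => exact hn
  | succ n hle ih =>
    refine ih ?_
    let B : Finset (AffineWeyl P) :=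
      (finite_wordBall b θ (n + 1)).toFinset.filter fun g => g ∉ wordBall b θ n
    have hB : wordBall b θ (n + 1) ⊆ wordBall b θ n ∪ B := by
      intro g hg
      by_cases hg' : g ∈ wordBall b θ n
      · exact Or.inl hg'
      · exact Or.inr (by simp [B, hg, hg'])
    have hcop : IsCoprime (∏ g ∈ B, twist g J) (I ^ l) := by
      refine (IsCoprime.prod_left fun g hg => ?_).pow_right
      rw [Ideal.isCoprime_iff_sup_eq]
      by_contra hne
      exact (Finset.mem_filter.mp hg).2 (wordBall_mono b θ hle (hn₀ hne))
    obtain ⟨u, hu, v, hv, huv⟩ := Ideal.isCoprime_iff_exists.mp hcop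
    have h1 : v • x = 0 := hl hv
    rw [← one_smul (SPrime P) x, ← huv, add_smul, h1, add_zero]
    exact prod_twist_smul_mem_wordFil hJ n hn hB hu

/-- A finitely generated `H'`-module which is locally finite over `S'` has finite length: a
submodule is determined, within a chain, by its intersection with a finite sum of generalized
weight spaces. -/
theorem isArtinian_isNoetherian_of_locallyFinite (hθ : IsMaxCoroot b θ)
    [hfg : Module.Finite (HPrime b θ h) M]
    (hM : ∀ m : M, Module.Finite k (SPrime P ⧸ Ideal.torsionOf (SPrime P) M m)) :
    IsArtinian (HPrime b θ h) M ∧ IsNoetherian (HPrime b θ h) M := by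
  classical
  obtain ⟨gens, hgens⟩ := hfg.fg_top
  let J : Ideal (SPrime P) := ⨅ m ∈ gens, Ideal.torsionOf (SPrime P) M m
  have : Module.Finite k (SPrime P ⧸ J) := finite_quotient_finset_inf _ _ fun m _ => hM m
  have hJ : ∀ m ∈ (gens : Set M), J ≤ Ideal.torsionOf (SPrime P) M m := fun m hm =>
    iInf₂_le (f := fun m (_ : m ∈ gens) => Ideal.torsionOf (SPrime P) M m) m hm
  obtain ⟨Ω, hΩ, hdesc⟩ := exists_finite_twist hθ h J
  let I : Ideal (SPrime P) := ∏ g ∈ hΩ.toFinset, twist g J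
  have hIJ : {g : AffineWeyl P | twist g J ⊔ I ≠ ⊤}.Finite := by
    refine (hΩ.biUnion fun g' _ => finite_setOf_twist_sup_ne_top J (twist g' J)).subset ?_
    intro g hg
    by_contra hne
    simp only [Set.mem_iUnion, Set.mem_ofPred_eq, not_exists, not_not] at hne
    apply hg
    rw [← Ideal.isCoprime_iff_sup_eq]
    refine IsCoprime.prod_right fun g' hg' => ?_
    rw [Ideal.isCoprime_iff_sup_eq]
    exact hne g' (hΩ.mem_toFinset.mp hg')
  obtain ⟨n₀, hn₀⟩ := exists_powerTorsion_le_wordFil hθ hgens hJ hIJ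
  have hfin : (Set.image2 (fun g m => ofG b θ h g • m) (wordBall b θ n₀) (gens : Set M)).Finite :=
    (finite_wordBall b θ n₀).image2 _ gens.finite_toSet
  have := hfin.to_subtype
  obtain ⟨hart, hnoe⟩ := isArtinian_isNoetherian_span hM
    (Set.image2 (fun g m => ofG b θ h g • m) (wordBall b θ n₀) (gens : Set M))
  have hart₁ : IsArtinian (SPrime P) (wordFil b θ h (gens : Set M) n₀) := hart
  have hnoe₁ : IsNoetherian (SPrime P) (wordFil b θ h (gens : Set M) n₀) := hnoe
  have hart' : IsArtinian (SPrime P) (powerTorsion I M) :=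
    isArtinian_of_injective (Submodule.inclusion hn₀) (Submodule.inclusion_injective hn₀)
  have hnoe' : IsNoetherian (SPrime P) (powerTorsion I M) :=
    isNoetherian_of_injective (Submodule.inclusion hn₀) (Submodule.inclusion_injective hn₀)
  let F : Submodule (HPrime b θ h) M → Submodule (SPrime P) (powerTorsion I M) := fun N =>
    (N.restrictScalars (SPrime P)).comap (powerTorsion I M).subtype
  have hF : StrictMono F := by
    intro N N' hlt
    refine lt_of_le_of_ne (fun x hx => hlt.le hx) fun heq => ?_
    -- the image of `N'` in `M ⧸ N` contains a nonzero vector killed by `I`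
    obtain ⟨y, hyN', hyN, hy⟩ : ∃ y ∈ N', y ∉ N ∧ ∀ p ∈ I, p • y ∈ N := by
      have hgens' : Submodule.span (HPrime b θ h) (N.mkQ '' gens) = ⊤ := by
        rw [Submodule.span_image, hgens, Submodule.map_top, Submodule.range_mkQ]
      have hJ' : ∀ m ∈ N.mkQ '' gens, J ≤ Ideal.torsionOf (SPrime P) (M ⧸ N) m := by
        rintro _ ⟨m, hm, rfl⟩ p hp
        have h1 : p • m = 0 := hJ m hm hp
        change p • N.mkQ m = 0
        rw [← ofS_smul b θ h, ← map_smul, ofS_smul, h1, map_zero]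
      have hne : N'.map N.mkQ ≠ ⊥ := by
        intro h0
        rw [← le_bot_iff, Submodule.map_le_iff_le_comap, Submodule.comap_bot,
          Submodule.ker_mkQ] at h0
        exact absurd (hlt.trans_le h0) (lt_irrefl _)
      obtain ⟨g, x, hx, hx0, hg⟩ := exists_twist_le_torsionOf hθ hJ' hgens' hne
      obtain ⟨g', hg', ⟨z, hz⟩, hz0, hgz⟩ := hdesc (N'.map N.mkQ)
        ⟨g, ⟨x, hx⟩, fun h0 => hx0 (congrArg Subtype.val h0), fun p hp => Subtype.ext (hg hp)⟩
      obtain ⟨y, hyN', rfl⟩ := hz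
      refine ⟨y, hyN', fun hyN => hz0 (Subtype.ext ((Submodule.Quotient.mk_eq_zero N).mpr hyN)),
        fun p hp => ?_⟩
      have h1 : p ∈ twist g' J := by
        have h2 := Ideal.prod_le_inf hp
        rw [Submodule.mem_finsetInf] at h2
        exact h2 g' (hΩ.mem_toFinset.mpr hg')
      have h2 : p • N.mkQ y = 0 := congrArg Subtype.val (hgz h1)
      rw [← ofS_smul b θ h, ← map_smul, ofS_smul] at h2
      exact (Submodule.Quotient.mk_eq_zero N).mp h2
    -- replace this vector by its component `r y` in the power torsion of `I`
    have := hM y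
    obtain ⟨n, r, hr, hrn⟩ := exists_one_sub_mem_mul_mem (k := k) I
      (Ideal.torsionOf (SPrime P) M y)
    have h1 : r • y ∈ powerTorsion I M := by
      refine ⟨n, fun p hp => ?_⟩
      have h2 : (r * p) • y = 0 := hrn p hp
      change p • r • y = 0
      rw [smul_smul, mul_comm, h2]
    have h2 : (⟨r • y, h1⟩ : powerTorsion I M) ∈ F N' := by
      change r • y ∈ N'
      rw [← ofS_smul b θ h]
      exact N'.smul_mem _ hyN'
    rw [← heq] at h2
    have h3 : r • y ∈ N := h2
    apply hyN
    have h4 := N.add_mem (hy _ hr) h3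
    rwa [← add_smul, sub_add_cancel, one_smul] at h4
  exact ⟨hF.wellFoundedLT, (isNoetherian_iff' ..).mpr hF.wellFoundedGT⟩

end LocallyFinite

/-! ### The categories of modules -/

section Categories

variable {b : P.Base} {θ : ι} {h : ι → k}

/-- The action of `S'` on an `H'`-module. -/
abbrev sPrimeModule (M : ModuleCat.{u} (HPrime b θ h)) : Module (SPrime P) M :=
  Module.compHom M (ofS b θ h : SPrime P →+* HPrime b θ h)

attribute [local instance] sPrimeModule

instance (M : ModuleCat.{u} (HPrime b θ h)) : IsScalarTower (SPrime P) (HPrime b θ h) M :=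
  ⟨fun p a m => mul_smul (ofS b θ h p) a m⟩

/-- The annihilator in `S'` of an element of an `H'`-module. -/
abbrev annS (M : ModuleCat.{u} (HPrime b θ h)) (m : M) : Ideal (SPrime P) :=
  Ideal.torsionOf (SPrime P) M m

lemma mem_annS {M : ModuleCat.{u} (HPrime b θ h)} {m : M} {p : SPrime P} :
    p ∈ annS M m ↔ ofS b θ h p • m = 0 := Iff.rfl

lemma annS_le_map {M N : ModuleCat.{u} (HPrime b θ h)} (f : M →ₗ[HPrime b θ h] N) (m : M) :
    annS M m ≤ annS N (f m) := fun p hp => by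
  rw [mem_annS] at hp ⊢
  rw [← map_smul, hp, map_zero]

lemma annS_map_le {M N : ModuleCat.{u} (HPrime b θ h)} (f : M →ₗ[HPrime b θ h] N)
    (hf : Function.Injective f) (m : M) : annS N (f m) ≤ annS M m := fun p hp => by
  rw [mem_annS] at hp ⊢
  exact hf (by rw [map_smul, hp, map_zero])

lemma fg_range_actOn_iff (M : ModuleCat.{u} (HPrime b θ h)) (m : M) :
    (LinearMap.range (actOn b θ h M m)).FG ↔ Module.Finite k (SPrime P ⧸ annS M m) := by
  rw [← Module.Finite.iff_fg]
  have hker : LinearMap.ker (actOn b θ h M m) = (annS M m).restrictScalars k := rfl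
  exact Module.Finite.equiv_iff ((LinearMap.quotKerEquivRange _).symm ≪≫ₗ
    Submodule.quotEquivOfEq _ _ hker ≪≫ₗ Submodule.Quotient.restrictScalarsEquiv k (annS M m))

lemma catO_iff (M : ModuleCat.{u} (HPrime b θ h)) :
    catO b θ h M ↔ Module.Finite (HPrime b θ h) M ∧
      ∀ m : M, Module.Finite k (SPrime P ⧸ annS M m) := by
  simp only [catO, fg_range_actOn_iff]

section Orbit

variable [Finite ι] [P.IsRootSystem]

lemma exists_iInf_maxIdeal_pow_le (E : Finset V) :
    ∃ n, 0 < n ∧ (⨅ μ ∈ E, maxIdeal P μ) ^ n ≤ ⨅ μ ∈ E, invIdeal P μ := by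
  choose n hn using fun μ : V => exists_maxIdeal_pow_le (P := P) μ
  refine ⟨E.sum n + 1, Nat.succ_pos _, le_iInf₂ fun μ hμ => ?_⟩
  refine le_trans ?_ (hn μ)
  refine (Ideal.pow_right_mono (iInf₂_le μ hμ) _).trans (Ideal.pow_le_pow_right ?_)
  exact (Finset.single_le_sum (fun _ _ => Nat.zero_le _) hμ).trans (Nat.le_succ _)

/-- In the definition of `^λO`, all conditions but finite generation follow from the last one. -/
lemma catOLam_iff (lam : V) (M : ModuleCat.{u} (HPrime b θ h)) :
    catOLam b θ h lam M ↔ Module.Finite (HPrime b θ h) M ∧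
      ∀ m : M, ∃ E : Finset V, (E : Set V) ⊆ MulAction.orbit (AffineWeyl P) lam ∧
        ⨅ μ ∈ E, invIdeal P μ ≤ annS M m := by
  refine ⟨fun hM => ⟨hM.1.1.1, hM.2⟩, fun ⟨hfg, hM⟩ => ⟨⟨(catO_iff M).mpr ⟨hfg, fun m => ?_⟩,
    fun m => ?_⟩, hM⟩⟩
  · obtain ⟨E, _, hE⟩ := hM m
    have := finite_quotient_finset_inf (k := k) E (fun μ => invIdeal P μ)
      fun μ _ => finite_quotient_invIdeal μ
    exact finite_quotient_of_le hE
  · obtain ⟨E, hEorb, hE⟩ := hM m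
    obtain ⟨n, hn, hle⟩ := exists_iInf_maxIdeal_pow_le (P := P) E
    exact ⟨E, hEorb, n, hn, fun p hp => hE (hle hp)⟩

end Orbit

section FiniteLength

variable [CharZero k] [Finite ι] [P.IsCrystallographic] [P.IsReduced] [P.IsRootSystem]
  [P.IsIrreducible]

lemma isArtinian_isNoetherian_of_catO (hθ : IsMaxCoroot b θ) {M : ModuleCat.{u} (HPrime b θ h)}
    (hM : catO b θ h M) : IsArtinian (HPrime b θ h) M ∧ IsNoetherian (HPrime b θ h) M := by
  obtain ⟨hfg, hM'⟩ := (catO_iff M).mp hM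
  exact isArtinian_isNoetherian_of_locallyFinite hθ hM'

lemma catO_of_injective (hθ : IsMaxCoroot b θ) {M N : ModuleCat.{u} (HPrime b θ h)}
    (f : M →ₗ[HPrime b θ h] N) (hf : Function.Injective f) (hN : catO b θ h N) : catO b θ h M := by
  have := (isArtinian_isNoetherian_of_catO hθ hN).2
  have := isNoetherian_of_injective f hf
  refine (catO_iff M).mpr ⟨inferInstance, fun m => ?_⟩
  have := ((catO_iff N).mp hN).2 (f m)
  exact finite_quotient_of_le (annS_map_le f hf m)

omit [CharZero k] [Finite ι] [P.IsCrystallographic] [P.IsReduced] [P.IsRootSystem]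
  [P.IsIrreducible] in
lemma catO_of_surjective {M N : ModuleCat.{u} (HPrime b θ h)}
    (f : M →ₗ[HPrime b θ h] N) (hf : Function.Surjective f) (hM : catO b θ h M) :
    catO b θ h N := by
  obtain ⟨hfg, hM'⟩ := (catO_iff M).mp hM
  refine (catO_iff N).mpr ⟨Module.Finite.of_surjective f hf, fun n => ?_⟩
  obtain ⟨m, rfl⟩ := hf n
  have := hM' m
  exact finite_quotient_of_le (annS_le_map f m)

lemma catOLam_of_injective (hθ : IsMaxCoroot b θ) {lam : V} {M N : ModuleCat.{u} (HPrime b θ h)}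
    (f : M →ₗ[HPrime b θ h] N) (hf : Function.Injective f) (hN : catOLam b θ h lam N) :
    catOLam b θ h lam M := by
  refine (catOLam_iff lam M).mpr ⟨(catO_of_injective hθ f hf hN.1.1).1, fun m => ?_⟩
  obtain ⟨E, hE, hE'⟩ := ((catOLam_iff lam N).mp hN).2 (f m)
  exact ⟨E, hE, hE'.trans (annS_map_le f hf m)⟩

omit [CharZero k] [P.IsCrystallographic] [P.IsReduced] [P.IsIrreducible] in
lemma catOLam_of_surjective {lam : V} {M N : ModuleCat.{u} (HPrime b θ h)}
    (f : M →ₗ[HPrime b θ h] N) (hf : Function.Surjective f) (hM : catOLam b θ h lam M) :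
    catOLam b θ h lam N := by
  refine (catOLam_iff lam N).mpr ⟨(catO_of_surjective f hf hM.1.1).1, fun n => ?_⟩
  obtain ⟨m, rfl⟩ := hf n
  obtain ⟨E, hE, hE'⟩ := ((catOLam_iff lam M).mp hM).2 m
  exact ⟨E, hE, hE'.trans (annS_le_map f m)⟩

omit [CharZero k] [Finite ι] [P.IsCrystallographic] [P.IsReduced] [P.IsRootSystem]
  [P.IsIrreducible] in
lemma catO_pi {J : Type} [Finite J] {F : J → ModuleCat.{u} (HPrime b θ h)}
    (hF : ∀ j, catO b θ h (F j)) : catO b θ h (ModuleCat.of (HPrime b θ h) (∀ j, F j)) := by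
  have hfg : ∀ j, Module.Finite (HPrime b θ h) (F j) := fun j => (hF j).1
  refine (catO_iff _).mpr ⟨Module.Finite.pi, fun m => ?_⟩
  let _ := Fintype.ofFinite J
  have := finite_quotient_finset_inf (k := k) Finset.univ (fun j => annS (F j) (m j))
    fun j _ => ((catO_iff (F j)).mp (hF j)).2 (m j)
  refine finite_quotient_of_le (I := ⨅ j ∈ Finset.univ, annS (F j) (m j)) fun p hp => ?_
  simp only [Submodule.mem_iInf] at hp
  exact funext fun j => hp j (Finset.mem_univ j)

open Limits

omit [CharZero k] [Finite ι] [P.IsCrystallographic] [P.IsReduced] [P.IsRootSystem]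
  [P.IsIrreducible] in
lemma isClosedUnderFiniteProducts_catO : (catO b θ h).IsClosedUnderFiniteProducts where
  isClosedUnderLimitsOfShape J _ :=
    { limitsOfShape_le := by
        rintro X ⟨pres⟩
        let F : J → ModuleCat.{u} (HPrime b θ h) := fun j => pres.diag.obj ⟨j⟩
        let e : X ≅ ModuleCat.of (HPrime b θ h) (∀ j, F j) :=
          IsLimit.conePointsIsoOfNatIso pres.isLimit (ModuleCat.productConeIsLimit F)
            (Discrete.natIso fun j => Iso.refl _)
        exact catO_of_surjective e.toLinearEquiv.symm.toLinearMap e.toLinearEquiv.symm.surjective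
          (catO_pi fun j => pres.prop_diag_obj ⟨j⟩) }

/-- `O'` is closed under subobjects, quotients and finite products, and each object of it has finite
length as a module. -/
lemma isArtinianCategory_catO (hθ : IsMaxCoroot b θ) :
    IsArtinianCategory (catO b θ h).FullSubcategory := by
  have h1 : (catO b θ h).IsClosedUnderSubobjects := ⟨fun f _ hY =>
    catO_of_injective hθ f.hom ((ModuleCat.mono_iff_injective f).mp inferInstance) hY⟩
  have h2 : (catO b θ h).IsClosedUnderQuotients := ⟨fun f _ hX =>
    catO_of_surjective f.hom ((ModuleCat.epi_iff_surjective f).mp inferInstance) hX⟩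
  have h3 : (catO b θ h).IsClosedUnderFiniteProducts := isClosedUnderFiniteProducts_catO
  have h4 : (catO b θ h).ContainsZero := by
    refine ⟨ModuleCat.of (HPrime b θ h) PUnit, ModuleCat.isZero_of_subsingleton _, ?_⟩
    refine (catO_iff _).mpr ⟨inferInstance, fun m => ?_⟩
    have : annS (ModuleCat.of (HPrime b θ h) PUnit) m = ⊤ :=
      (Ideal.eq_top_iff_one _).mpr (Subsingleton.elim _ _)
    have : Subsingleton (SPrime P ⧸ annS (ModuleCat.of (HPrime b θ h) PUnit) m) :=
      Ideal.Quotient.subsingleton_iff.mpr this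
    infer_instance
  refine ⟨⟨inferInstance⟩, fun X => ?_⟩
  obtain ⟨hart, hnoe⟩ := isArtinian_isNoetherian_of_catO hθ X.property
  let F : Subobject X → Submodule (HPrime b θ h) X.obj := fun S => LinearMap.range S.arrow.hom.hom
  have hinj : ∀ S : Subobject X, Function.Injective S.arrow.hom.hom := fun S => by
    have := (catO b θ h).preservesMonomorphisms_ι_of_isNormalEpiCategory
    exact (ModuleCat.mono_iff_injective _).mp ((catO b θ h).ι.map_mono S.arrow)
  have hF : StrictMono F := by
    intro S T hlt
    have hcomp : ∀ x, T.arrow.hom.hom ((S.ofLE T hlt.le).hom.hom x) = S.arrow.hom.hom x := by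
      intro x
      have := congrArg (fun f => f.hom.hom x) (Subobject.ofLE_arrow hlt.le)
      exact this
    refine lt_of_le_of_ne ?_ fun heq => ?_
    · rintro _ ⟨x, rfl⟩
      exact ⟨_, hcomp x⟩
    · have hbij : Function.Bijective (S.ofLE T hlt.le).hom.hom := by
        refine ⟨fun x y hxy => hinj S ?_, fun y => ?_⟩
        · rw [← hcomp, ← hcomp, hxy]
        · have : T.arrow.hom.hom y ∈ F S := heq ▸ ⟨y, rfl⟩
          obtain ⟨x, hx⟩ := this
          exact ⟨x, hinj T (by rw [hcomp, hx])⟩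
      have hiso : IsIso ((catO b θ h).ι.map (S.ofLE T hlt.le)) :=
        (ConcreteCategory.isIso_iff_bijective _).mpr hbij
      have := isIso_of_reflects_iso (S.ofLE T hlt.le) (catO b θ h).ι
      exact hlt.not_ge (Subobject.le_of_comm (inv (S.ofLE T hlt.le)) (by simp))
  exact ⟨⟨hF.wellFoundedLT⟩, ⟨hF.wellFoundedGT⟩⟩

end FiniteLength

end Categories

/-! ### The modules `P(μ)` -/

section FinitelyManySimpleQuotients

/-- A module of finite length has only finitely many simple quotients up to isomorphism. -/
lemma exists_finite_simple_quotients {R : Type u} [Ring R] {M : Type u} [AddCommGroup M]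
    [Module R M] (hM : IsFiniteLength R M) :
    ∃ T : Set (ModuleCat.{u} R), T.Finite ∧ ∀ (S : Type u) [AddCommGroup S] [Module R S]
      [IsSimpleModule R S] (f : M →ₗ[R] S), Function.Surjective f →
      ∃ L ∈ T, Nonempty (S ≃ₗ[R] L) := by
  induction hM with
  | of_subsingleton =>
    refine ⟨∅, Set.finite_empty, fun S _ _ _ f hf => ?_⟩
    have := IsSimpleModule.nontrivial R S
    have := hf.subsingleton
    exact absurd this (not_subsingleton S)
  | of_simple_quotient _ ih =>
    rename_i M _ _ N _ _
    obtain ⟨T, hT, hT'⟩ := ih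
    refine ⟨insert (ModuleCat.of R (M ⧸ N)) T, hT.insert _, fun S _ _ _ f hf => ?_⟩
    rcases LinearMap.surjective_or_eq_zero (f ∘ₗ N.subtype) with hs | h0
    · obtain ⟨L, hL, hL'⟩ := hT' S _ hs
      exact ⟨L, Set.mem_insert_of_mem _ hL, hL'⟩
    · have hle : N ≤ LinearMap.ker f := fun x hx => LinearMap.congr_fun h0 ⟨x, hx⟩
      have hsurj : Function.Surjective (N.liftQ f hle) := by
        intro s
        obtain ⟨x, rfl⟩ := hf s
        exact ⟨N.mkQ x, N.liftQ_apply f x⟩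
      have := IsSimpleModule.nontrivial R S
      have hne : N.liftQ f hle ≠ 0 := by
        intro h0
        obtain ⟨s, hs⟩ := exists_ne (0 : S)
        obtain ⟨x, hx⟩ := hsurj s
        rw [h0] at hx
        exact hs hx.symm
      exact ⟨_, Set.mem_insert _ _, ⟨(LinearEquiv.ofBijective _
        ⟨(LinearMap.injective_or_eq_zero _).resolve_right hne, hsurj⟩).symm⟩⟩

end FinitelyManySimpleQuotients

section Generators

variable {b : P.Base} {θ : ι} {h : ι → k}

attribute [local instance] sPrimeModule

variable (b θ h) in
/-- The generator of `P(μ)`. -/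
def PMod.gen (μ : V) : PMod b θ h μ :=
  Submodule.Quotient.mk (1 : HPrime b θ h)

lemma PMod.smul_gen (μ : V) (a : HPrime b θ h) :
    a • PMod.gen b θ h μ = (Submodule.Quotient.mk a :
      HPrime b θ h ⧸ Submodule.span (HPrime b θ h) (ofS b θ h '' (invIdeal P μ : Set (SPrime P)))) :=
  congrArg Submodule.Quotient.mk (mul_one a)

lemma PMod.exists_smul_gen {μ : V} (x : PMod b θ h μ) :
    ∃ a : HPrime b θ h, x = a • PMod.gen b θ h μ := by
  obtain ⟨a, ha⟩ := Submodule.Quotient.mk_surjective _ x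
  exact ⟨a, ha.symm.trans (PMod.smul_gen μ a).symm⟩

lemma PMod.invIdeal_le_annS_gen (μ : V) : invIdeal P μ ≤ annS _ (PMod.gen b θ h μ) := fun p hp => by
  rw [mem_annS, PMod.smul_gen]
  exact (Submodule.Quotient.mk_eq_zero _).mpr (Submodule.subset_span ⟨p, hp, rfl⟩)

lemma PMod.hom_ext {μ : V} {M : ModuleCat.{u} (HPrime b θ h)}
    {f g : PMod b θ h μ →ₗ[HPrime b θ h] M} (hfg : f (PMod.gen b θ h μ) = g (PMod.gen b θ h μ)) :
    f = g := by
  ext x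
  obtain ⟨a, rfl⟩ := PMod.exists_smul_gen x
  rw [map_smul, map_smul, hfg]

/-- `Hom(P(μ), M)` consists of the elements of `M` killed by `[μ]`. -/
lemma PMod.exists_hom {μ : V} {M : ModuleCat.{u} (HPrime b θ h)} {m : M}
    (hm : invIdeal P μ ≤ annS M m) :
    ∃ f : PMod b θ h μ →ₗ[HPrime b θ h] M, f (PMod.gen b θ h μ) = m := by
  refine ⟨Submodule.liftQ _ (LinearMap.toSpanSingleton (HPrime b θ h) M m) ?_, ?_⟩
  · rw [Submodule.span_le]
    rintro _ ⟨p, hp, rfl⟩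
    exact hm hp
  · exact one_smul (HPrime b θ h) m

lemma isCoprime_prod_invIdeal [Finite ι] [P.IsRootSystem] {μ : V} {E : Finset V} (hμ : μ ∉ E) :
    IsCoprime (invIdeal P μ) (∏ ν ∈ E, invIdeal P ν) :=
  IsCoprime.prod_right fun _ hν => isCoprime_invIdeal fun h => hμ (h ▸ hν)

/-- The component in the weight `μ` of an element killed by `[E]` is obtained by the action of an
element of `S'` congruent to one modulo `[μ]`. -/
lemma exists_invIdeal_le_annS_smul [Finite ι] [P.IsRootSystem] {M : ModuleCat.{u} (HPrime b θ h)}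
    {m : M} {μ : V} {E : Finset V} (hμ : μ ∉ E)
    (hm : invIdeal P μ ⊓ ⨅ ν ∈ E, invIdeal P ν ≤ annS M m) :
    ∃ r : SPrime P, 1 - r ∈ invIdeal P μ ∧ r ∈ ⨅ ν ∈ E, invIdeal P ν ∧
      invIdeal P μ ≤ annS M (r • m) := by
  obtain ⟨u, hu, r, hr, hur⟩ := Ideal.isCoprime_iff_exists.mp
    (isCoprime_prod_invIdeal (P := P) hμ)
  have hr' : r ∈ ⨅ ν ∈ E, invIdeal P ν := by
    have := Ideal.prod_le_inf hr
    rwa [Finset.inf_eq_iInf] at this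
  refine ⟨r, by rwa [← hur, add_sub_cancel_right], hr', fun p hp => ?_⟩
  have h1 : (p * r) • m = 0 := hm ⟨Ideal.mul_mem_right _ _ hp, Ideal.mul_mem_left _ _ hr'⟩
  change p • r • m = 0
  rwa [smul_smul]

lemma exists_surjective_directSum [Finite ι] [P.IsRootSystem] {lam : V}
    {M : ModuleCat.{u} (HPrime b θ h)} (hM : catOLam b θ h lam M) :
    ∃ (n : ℕ) (μ : Fin n → V), (∀ i, μ i ∈ MulAction.orbit (AffineWeyl P) lam) ∧
      ∃ f : (⨁ i, PMod b θ h (μ i)) →ₗ[HPrime b θ h] M, Function.Surjective f := by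
  classical
  obtain ⟨hfg, hM'⟩ := (catOLam_iff lam M).mp hM
  let G : Set M := {x | ∃ μ ∈ MulAction.orbit (AffineWeyl P) lam, invIdeal P μ ≤ annS M x}
  have key : ∀ (E : Finset V), (E : Set V) ⊆ MulAction.orbit (AffineWeyl P) lam →
      ∀ m : M, ⨅ μ ∈ E, invIdeal P μ ≤ annS M m → m ∈ Submodule.span (HPrime b θ h) G := by
    intro E
    induction E using Finset.induction_on with
    | empty =>
      intro _ m hm
      have h1 : (1 : SPrime P) • m = 0 := hm (by simp)
      rw [one_smul] at h1
      rw [h1]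
      exact zero_mem _
    | insert μ E hμ ih =>
      intro hE m hm
      rw [Finset.iInf_insert] at hm
      obtain ⟨r, hr, hr', hrm⟩ := exists_invIdeal_le_annS_smul hμ hm
      have h1 : m = (1 - r) • m + r • m := by rw [← add_smul, sub_add_cancel, one_smul]
      rw [h1]
      refine add_mem (ih (fun ν hν => hE (Finset.mem_insert_of_mem hν)) _ fun p hp => ?_)
        (Submodule.subset_span ⟨μ, hE (Finset.mem_insert_self _ _), hrm⟩)
      have h2 : (p * (1 - r)) • m = 0 :=
        hm ⟨Ideal.mul_mem_left _ _ hr, Ideal.mul_mem_right _ _ hp⟩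
      change p • (1 - r) • m = 0
      rwa [smul_smul]
  have hspan : Submodule.span (HPrime b θ h) G = ⊤ := by
    rw [eq_top_iff]
    intro m _
    obtain ⟨E, hE, hE'⟩ := hM' m
    exact key E hE m hE'
  obtain ⟨s, hs, hspan'⟩ := (Submodule.fg_span_iff_fg_span_finset_subset G).mp
    (hspan ▸ hfg.fg_top)
  let e := s.equivFin
  have hx : ∀ i : Fin s.card, ∃ μ ∈ MulAction.orbit (AffineWeyl P) lam,
      invIdeal P μ ≤ annS M (e.symm i : M) := fun i => hs (e.symm i).2
  choose μ hμ hμ' using hx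
  choose f hf using fun i => PMod.exists_hom (hμ' i)
  refine ⟨s.card, μ, hμ, DirectSum.toModule _ _ _ f, ?_⟩
  rw [← LinearMap.range_eq_top, eq_top_iff, ← hspan, hspan', Submodule.span_le]
  intro x hx
  refine ⟨DirectSum.lof (HPrime b θ h) _ _ (e ⟨x, hx⟩) (PMod.gen b θ h _), ?_⟩
  rw [DirectSum.toModule_lof, hf, Equiv.symm_apply_apply]

variable [CharZero k] [Finite ι] [P.IsCrystallographic] [P.IsReduced] [P.IsRootSystem]
  [P.IsIrreducible]

lemma catOLam_PMod (hθ : IsMaxCoroot b θ) {lam μ : V}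
    (hμ : μ ∈ MulAction.orbit (AffineWeyl P) lam) : catOLam b θ h lam (PMod b θ h μ) := by
  classical
  have hstable : ∀ (a : HPrime b θ h) (m : PMod b θ h μ),
      (∃ E : Finset V, (E : Set V) ⊆ MulAction.orbit (AffineWeyl P) lam ∧
        ⨅ μ ∈ E, invIdeal P μ ≤ annS _ m) →
      ∃ E : Finset V, (E : Set V) ⊆ MulAction.orbit (AffineWeyl P) lam ∧
        ⨅ μ ∈ E, invIdeal P μ ≤ annS _ (a • m) := by
    intro a
    induction a using hPrime_induction hθ with
    | ofS p =>
      rintro m ⟨E, hE, hE'⟩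
      refine ⟨E, hE, fun q hq => ?_⟩
      have h1 : q • m = 0 := hE' hq
      change q • p • m = 0
      rw [smul_comm, h1, smul_zero]
    | refl i =>
      rintro m ⟨E, hE, hE'⟩
      refine ⟨_, ?_, iInf_invIdeal_le_torsionOf_simpleRefl_smul i hE'⟩
      rw [Finset.coe_union, Finset.coe_image, Set.union_subset_iff]
      refine ⟨hE, ?_⟩
      rintro _ ⟨ν, hν, rfl⟩
      obtain ⟨g, rfl⟩ := hE hν
      exact ⟨simpleRefl b θ i * g, mul_smul _ _ _⟩
    | mul a a' ha ha' =>
      intro m hm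
      rw [mul_smul]
      exact ha _ (ha' _ hm)
    | add a a' ha ha' =>
      intro m hm
      obtain ⟨E, hE, hE'⟩ := ha m hm
      obtain ⟨F, hF, hF'⟩ := ha' m hm
      refine ⟨E ∪ F, by rw [Finset.coe_union]; exact Set.union_subset hE hF, fun p hp => ?_⟩
      rw [Finset.iInf_union] at hp
      have h1 : p • a • m = 0 := hE' hp.1
      have h2 : p • a' • m = 0 := hF' hp.2
      change p • (a + a') • m = 0
      rw [add_smul, smul_add, h1, h2, add_zero]
  have hfin : Module.Finite (HPrime b θ h) (PMod b θ h μ) :=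
    Module.Finite.of_surjective (LinearMap.toSpanSingleton (HPrime b θ h) (PMod b θ h μ)
      (PMod.gen b θ h μ)) fun x => (PMod.exists_smul_gen x).imp fun _ ha => ha.symm
  refine (catOLam_iff lam _).mpr ⟨hfin, fun m => ?_⟩
  obtain ⟨a, rfl⟩ := PMod.exists_smul_gen m
  refine hstable a _ ⟨{μ}, by simpa using hμ, ?_⟩
  simpa using PMod.invIdeal_le_annS_gen μ

omit [CharZero k] [P.IsCrystallographic] [P.IsReduced] [P.IsIrreducible] in
lemma surjective_of_epi {lam : V} {M N : (catOLam b θ h lam).FullSubcategory} (e : M ⟶ N) [Epi e] :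
    Function.Surjective e.hom.hom := by
  let Q : (catOLam b θ h lam).FullSubcategory :=
    ⟨ModuleCat.of _ (N.obj ⧸ LinearMap.range e.hom.hom),
      catOLam_of_surjective (LinearMap.range e.hom.hom).mkQ (Submodule.mkQ_surjective _) N.property⟩
  let q : N ⟶ Q := ObjectProperty.homMk (ModuleCat.ofHom (LinearMap.range e.hom.hom).mkQ)
  let z : N ⟶ Q := ObjectProperty.homMk (ModuleCat.ofHom 0)
  have h1 : e ≫ q = e ≫ z := by
    refine ObjectProperty.hom_ext _ (ModuleCat.hom_ext (LinearMap.ext fun x => ?_))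
    exact (Submodule.Quotient.mk_eq_zero _).mpr ⟨x, rfl⟩
  have h2 : q = z := (cancel_epi e).mp h1
  intro y
  have h3 : (LinearMap.range e.hom.hom).mkQ y = 0 := congrArg (fun f => f.hom.hom y) h2
  exact (Submodule.Quotient.mk_eq_zero _).mp h3

lemma projective_PMod (hθ : IsMaxCoroot b θ) {lam μ : V}
    (hμ : μ ∈ MulAction.orbit (AffineWeyl P) lam) :
    Projective (⟨PMod b θ h μ, catOLam_PMod hθ hμ⟩ : (catOLam b θ h lam).FullSubcategory) := by
  classical
  refine ⟨fun {M N} f e _ => ?_⟩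
  obtain ⟨m, hm⟩ := surjective_of_epi e (f.hom.hom (PMod.gen b θ h μ))
  obtain ⟨E, hE, hE'⟩ := ((catOLam_iff lam M.obj).mp M.property).2 m
  have hle : invIdeal P μ ⊓ ⨅ ν ∈ E.erase μ, invIdeal P ν ≤ annS M.obj m := by
    rw [← Finset.iInf_insert]
    refine le_trans (biInf_mono fun ν hν => ?_) hE'
    by_cases hνμ : ν = μ
    · exact hνμ ▸ Finset.mem_insert_self _ _
    · exact Finset.mem_insert_of_mem (Finset.mem_erase.mpr ⟨hνμ, hν⟩)
  obtain ⟨r, hr, _, hrm⟩ := exists_invIdeal_le_annS_smul (Finset.notMem_erase μ E) hle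
  obtain ⟨f', hf'⟩ := PMod.exists_hom hrm
  refine ⟨ObjectProperty.homMk (ModuleCat.ofHom f'),
    ObjectProperty.hom_ext _ (ModuleCat.hom_ext (PMod.hom_ext ?_))⟩
  change e.hom.hom (f' (PMod.gen b θ h μ)) = f.hom.hom (PMod.gen b θ h μ)
  have h1 : (1 - r) • f.hom.hom (PMod.gen b θ h μ) = 0 :=
    annS_le_map f.hom.hom _ (PMod.invIdeal_le_annS_gen μ hr)
  have h2 : e.hom.hom (r • m) = r • f.hom.hom (PMod.gen b θ h μ) := by
    rw [← hm]
    exact map_smul e.hom.hom (ofS b θ h r) m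
  rw [hf', h2]
  rw [sub_smul, one_smul, sub_eq_zero] at h1
  exact h1.symm

lemma isSimpleModule_of_simple (hθ : IsMaxCoroot b θ) {lam : V}
    (S : (catOLam b θ h lam).FullSubcategory) [hS : Simple S] :
    IsSimpleModule (HPrime b θ h) S.obj := by
  have hnt : Nontrivial S.obj := by
    by_contra hc
    rw [not_nontrivial_iff_subsingleton] at hc
    refine id_nonzero S (ObjectProperty.hom_ext _ (ModuleCat.hom_ext (LinearMap.ext fun x => ?_)))
    exact Subsingleton.elim _ _
  rw [isSimpleModule_iff]
  refine { toNontrivial := inferInstance, eq_bot_or_eq_top := fun N => ?_ }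
  let T : (catOLam b θ h lam).FullSubcategory :=
    ⟨ModuleCat.of _ N, catOLam_of_injective hθ N.subtype N.injective_subtype S.property⟩
  let j : T ⟶ S := ObjectProperty.homMk (ModuleCat.ofHom N.subtype)
  have hj : Mono j := by
    refine ⟨fun {Z} f g hfg => ObjectProperty.hom_ext _ (ModuleCat.hom_ext (LinearMap.ext fun x => ?_))⟩
    exact N.injective_subtype (congrArg (fun u => u.hom.hom x) hfg)
  by_cases h0 : j = 0
  · left
    rw [Submodule.eq_bot_iff]
    intro x hx
    exact congrArg (fun u => u.hom.hom (⟨x, hx⟩ : N)) h0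
  · right
    have := (hS.mono_isIso_iff_nonzero j).mpr h0
    rw [eq_top_iff]
    intro x _
    have h1 := congrArg (fun u => u.hom.hom x) (IsIso.inv_hom_id j)
    have h2 : N.subtype ((inv j).hom.hom x) = x := h1
    rw [← h2]
    exact Subtype.property _

/-- Every simple object of `^λO` is a quotient of one of finitely many modules `P(gλ)`, which have
finite length. -/
lemma exists_finite_simple (hθ : IsMaxCoroot b θ) (h : ι → k) (lam : V) :
    ∃ T : Set (ModuleCat.{u} (HPrime b θ h)), T.Finite ∧
      ∀ S : (catOLam b θ h lam).FullSubcategory, Simple S →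
        ∃ L ∈ T, Nonempty (S.obj ≃ₗ[HPrime b θ h] L) := by
  obtain ⟨Ω, hΩ, hdesc⟩ := exists_finite_twist hθ h (invIdeal P lam)
  have hlen : ∀ g : AffineWeyl P, IsFiniteLength (HPrime b θ h) (PMod b θ h (g • lam)) := by
    intro g
    obtain ⟨hart, hnoe⟩ := isArtinian_isNoetherian_of_catO hθ
      (catOLam_PMod (h := h) hθ (MulAction.mem_orbit lam g)).1.1
    exact isFiniteLength_iff_isNoetherian_isArtinian.mpr ⟨hnoe, hart⟩
  choose T hT hT' using fun g => exists_finite_simple_quotients (hlen g)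
  refine ⟨⋃ g ∈ Ω, T g, hΩ.biUnion fun g _ => hT g, fun S hS => ?_⟩
  have := isSimpleModule_of_simple hθ S
  have := IsSimpleModule.nontrivial (HPrime b θ h) S.obj
  obtain ⟨x, hx⟩ := exists_ne (0 : S.obj)
  obtain ⟨E, hE, hE'⟩ := ((catOLam_iff lam S.obj).mp S.property).2 x
  have hprod : ∏ μ ∈ E, invIdeal P μ ≤ annS S.obj x := by
    refine le_trans (Ideal.prod_le_inf.trans ?_) hE'
    rw [Finset.inf_eq_iInf]
  obtain ⟨μ, hμ, a, ha, hμa⟩ := exists_smul_ne_zero_of_prod E (fun μ => invIdeal P μ) hx hprod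
  obtain ⟨g, rfl⟩ := hE hμ
  obtain ⟨g', hg', y, hy, hgy⟩ := hdesc S.obj ⟨g, a • x, ha, by rw [twist_invIdeal]; exact hμa⟩
  rw [twist_invIdeal] at hgy
  obtain ⟨f, hf⟩ := PMod.exists_hom (h := h) hgy
  have hsurj : Function.Surjective f := by
    refine (LinearMap.surjective_or_eq_zero f).resolve_right fun h0 => hy ?_
    rw [← hf, h0, LinearMap.zero_apply]
  obtain ⟨L, hL, hL'⟩ := hT' g' S.obj f hsurj
  exact ⟨L, Set.mem_biUnion hg' hL, hL'⟩

lemma exists_fin_simple (hθ : IsMaxCoroot b θ) (h : ι → k) (lam : V) :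
    ∃ (n : ℕ) (L : Fin n → (catOLam b θ h lam).FullSubcategory), (∀ i, Simple (L i)) ∧
      ∀ S : (catOLam b θ h lam).FullSubcategory, Simple S → ∃ i, Nonempty (S ≅ L i) := by
  obtain ⟨T, hT, hT'⟩ := exists_finite_simple hθ h lam
  let A : Set (ModuleCat.{u} (HPrime b θ h)) := {L ∈ T | ∃ S : (catOLam b θ h lam).FullSubcategory,
    Simple S ∧ Nonempty (S.obj ≃ₗ[HPrime b θ h] L)}
  have hA : Finite A := (hT.subset (Set.sep_subset _ _)).to_subtype
  obtain ⟨n, ⟨e⟩⟩ := Finite.exists_equiv_fin A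
  choose S hS hSiso using fun L : A => L.2.2
  refine ⟨n, fun i => S (e.symm i), fun i => hS _, fun S' hS' => ?_⟩
  obtain ⟨L, hL, ⟨u⟩⟩ := hT' S' hS'
  let L' : A := ⟨L, hL, S', hS', ⟨u⟩⟩
  obtain ⟨v⟩ := hSiso L'
  refine ⟨e L', ⟨?_⟩⟩
  simp only [Equiv.symm_apply_apply]
  exact (catOLam b θ h lam).fullyFaithfulι.preimageIso (u.trans v.symm).toModuleIso

end Generators

end DDAHA

end

theorem proposition2p2 {k ι V V' : Type u} [Field k] [CharZero k] [Finite ι]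
    [AddCommGroup V] [Module k V] [AddCommGroup V'] [Module k V']
    (P : RootPairing ι k V V') [P.IsRootSystem] [P.IsCrystallographic] [P.IsReduced]
    [P.IsIrreducible] (b : P.Base) (θ : ι) (hθ : DDAHA.IsMaxCoroot b θ)
    (h : ι → k) (hh : ∀ i j, h (P.reflectionPerm i j) = h j) (lam : V) :
    -- each `P(μ)` is a projective object of `^λO`
    (∀ μ ∈ MulAction.orbit (DDAHA.AffineWeyl P) lam,
      ∃ hμ : DDAHA.catOLam b θ h lam (DDAHA.PMod b θ h μ),
        Projective (⟨DDAHA.PMod b θ h μ, hμ⟩ : (DDAHA.catOLam b θ h lam).FullSubcategory)) ∧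
    -- every object of `^λO` is a quotient of a finite direct sum of modules `P(μ)`
    (∀ M : (DDAHA.catOLam b θ h lam).FullSubcategory,
      ∃ (n : ℕ) (μ : Fin n → V), (∀ i, μ i ∈ MulAction.orbit (DDAHA.AffineWeyl P) lam) ∧
        ∃ f : (⨁ i, DDAHA.PMod b θ h (μ i)) →ₗ[DDAHA.HPrime b θ h] M.obj,
          Function.Surjective f) ∧
    -- `O'` is Artinian
    DDAHA.IsArtinianCategory (DDAHA.catO b θ h).FullSubcategory ∧
    -- `^λO` has finitely many simple objects up to isomorphism
    (∃ (n : ℕ) (L : Fin n → (DDAHA.catOLam b θ h lam).FullSubcategory), (∀ i, Simple (L i)) ∧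
      ∀ S : (DDAHA.catOLam b θ h lam).FullSubcategory, Simple S → ∃ i, Nonempty (S ≅ L i)) :=
  ⟨fun _ hμ => ⟨DDAHA.catOLam_PMod hθ hμ, DDAHA.projective_PMod hθ hμ⟩,
    fun M => DDAHA.exists_surjective_directSum M.property, DDAHA.isArtinianCategory_catO hθ,
    DDAHA.exists_fin_simple hθ h lam⟩
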